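/- **Lemma (classical vs. quantum capacities of Channel II).** For $\varepsilon\in[0,1]$ let Channel II be the memoryless channel with two senders and two receivers in which sender $i$ inputs two bits $X_i=m_ia_i$ and receiver $i$ receives $Y_i\in\{0,1,e\}$. If $a_1\oplus a_2=m_1m_2$, then $(Y_1,Y_2)=(m_1,m_2)$ with probability $\varepsilon$ and $(Y_1,Y_2)=(e,e)$ with probability $1-\varepsilon$; otherwise $(Y_1,Y_2)=(e,e)$ with certainty. For a class of encoding strategies let the sum-capacity be the supremum of $R_1+R_2$, in bits per channel use, over all rate pairs for which some sequence of $(2^{nR_1},2^{nR_2},n)$ codes with encoders in that class, and with receiver $i$ decoding message $i$ from $Y_i^n$ alone, has probability of error (at either receiver, for independent uniform messages) tending to $0$. Let $C^{(\varepsilon)}_{\mathrm{classical}}$ be the sum-capacity when the senders agree on a (possibly randomized) strategy beforehand and do not communicate, and let $C^{(\varepsilon)}_{\mathrm{quantum}}$ be the sum-capacity when, in addition, they share a finite-dimensional bipartite quantum state and each inputs a function of the own message and the outcome of a measurement, chosen by that message, on the own half. 1. For all $\varepsilon\in[0,1]$, $\;C^{(\varepsilon)}_{\mathrm{quantum}}\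 \ge\ 2\cos^2(\pi/8)\,\varepsilon\approx 1.707\,\varepsilon$ (bits). 2. As $\varepsilon\to0^+$, $C^{(\varepsilon)}_{\mathrm{classical}}$ is at most $1.255\,\varepsilon+O(\varepsilon^2)$ nats, that is, $C^{(\varepsilon)}_{\mathrm{classical}}\ \le\ \dfrac{1.255}{\ln 2}\,\varepsilon+O(\varepsilon^2)$ (bits). 3. For all sufficiently small $\varepsilon>0$, $\;C^{(\varepsilon)}_{\mathrm{classical}}<C^{(\varepsilon)}_{\mathrm{quantum}}$. For every $d\ge2$, parts 1 and 3 also hold, with the same range of $\varepsilon$, if the shared entanglement is restricted to one bipartite state of a qubit and a $d$-level system per channel use. -/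

import Mathlib

open scoped BigOperators Kronecker ComplexOrder

noncomputable section

namespace Interference

/-- A discrete memoryless two-sender two-receiver channel:
`p x₁ x₂ y₁ y₂` is the probability of the outputs `(y₁, y₂)` on the inputs `(x₁, x₂)`. -/
structure InterferenceChannel (X₁ X₂ Y₁ Y₂ : Type) [Fintype Y₁] [Fintype Y₂] where
  p : X₁ → X₂ → Y₁ → Y₂ → ℝ
  nonneg : ∀ x₁ x₂ y₁ y₂, 0 ≤ p x₁ x₂ y₁ y₂
  sum_one : ∀ x₁ x₂, ∑ y₁, ∑ y₂, p x₁ x₂ y₁ y₂ = 1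

/-- The conditional law of the two codewords of block length `n`, given the two messages:
`Q m₁ m₂ x₁ x₂` is the probability that the senders input `x₁` and `x₂` on messages
`m₁` and `m₂`. -/
abbrev Behaviour (X₁ X₂ : Type) (n M₁ M₂ : ℕ) : Type :=
  Fin M₁ → Fin M₂ → (Fin n → X₁) → (Fin n → X₂) → ℝ

/-- A class of encoding strategies: which behaviours the two senders can realize, for each block
length and each pair of message-set sizes. -/
abbrev StrategyClass (X₁ X₂ : Type) : Type :=
  ∀ n M₁ M₂ : ℕ, Set (Behaviour X₁ X₂ n M₁ M₂)

section Codes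

variable {X₁ X₂ Y₁ Y₂ : Type} [Fintype X₁] [Fintype X₂] [Fintype Y₁] [Fintype Y₂]

/-- A code: an encoding behaviour of the two senders, and a decoding rule for each receiver, who
sees only the own output sequence. The value `none` is the declaration of an error. -/
structure Code (X₁ X₂ Y₁ Y₂ : Type) (n M₁ M₂ : ℕ) where
  enc : Behaviour X₁ X₂ n M₁ M₂
  dec₁ : (Fin n → Y₁) → Option (Fin M₁)
  dec₂ : (Fin n → Y₂) → Option (Fin M₂)

/-- Probability that not both messages are decoded correctly, for independent uniform messages
and `n` independent uses of the channel. -/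
def Code.errorProb {n M₁ M₂ : ℕ} (C : Code X₁ X₂ Y₁ Y₂ n M₁ M₂)
    (W : InterferenceChannel X₁ X₂ Y₁ Y₂) : ℝ :=
  (∑ m₁ : Fin M₁, ∑ m₂ : Fin M₂, ∑ x₁ : Fin n → X₁, ∑ x₂ : Fin n → X₂,
    ∑ y₁ : Fin n → Y₁, ∑ y₂ : Fin n → Y₂,
      C.enc m₁ m₂ x₁ x₂ * (∏ t, W.p (x₁ t) (x₂ t) (y₁ t) (y₂ t)) *
        (if C.dec₁ y₁ = some m₁ ∧ C.dec₂ y₂ = some m₂ then 0 else 1)) / ((M₁ : ℝ) * (M₂ : ℝ))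

/-- The rate pair `(R₁, R₂)`, in bits per channel use, is achievable on `W` with strategies from
the class `S`: for some sequence of `(2 ^ (n R₁), 2 ^ (n R₂), n)` codes the error probability
tends to `0`. -/
def Achievable (W : InterferenceChannel X₁ X₂ Y₁ Y₂) (S : StrategyClass X₁ X₂)
    (R₁ R₂ : ℝ) : Prop :=
  0 ≤ R₁ ∧ 0 ≤ R₂ ∧
    ∃ C : ∀ n : ℕ, Code X₁ X₂ Y₁ Y₂ n ⌈(2 : ℝ) ^ ((n : ℝ) * R₁)⌉₊ ⌈(2 : ℝ) ^ ((n : ℝ) * R₂)⌉₊,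
      (∀ n, (C n).enc ∈ S n _ _) ∧
      Filter.Tendsto (fun n => (C n).errorProb W) Filter.atTop (nhds 0)

/-- The sum-capacity of `W` with strategies from `S`, in bits per channel use: the supremum of
`R₁ + R₂` over the achievable rate pairs. -/
def sumCapacity (W : InterferenceChannel X₁ X₂ Y₁ Y₂) (S : StrategyClass X₁ X₂) : EReal :=
  sSup {c : EReal | ∃ R₁ R₂ : ℝ, Achievable W S R₁ R₂ ∧ c = ((R₁ + R₂ : ℝ) : EReal)}

end Codes

section Strategies

variable {X₁ X₂ : Type} [DecidableEq X₁] [DecidableEq X₂]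

/-- Classical strategies: the senders agree beforehand on a (possibly randomized) choice `i` among
finitely many pairs of encoders; then each encodes the own message without communication. -/
def classicalStrategies : StrategyClass X₁ X₂ := fun n M₁ M₂ =>
  {Q | ∃ (k : ℕ) (w : Fin k → ℝ)
      (f₁ : Fin k → Fin M₁ → Fin n → X₁) (f₂ : Fin k → Fin M₂ → Fin n → X₂),
      (∀ i, 0 ≤ w i) ∧ ∑ i, w i = 1 ∧
      ∀ m₁ m₂ x₁ x₂, Q m₁ m₂ x₁ x₂ =
        ∑ i, if f₁ i m₁ = x₁ ∧ f₂ i m₂ = x₂ then w i else 0}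

/-- Density matrices. -/
def IsState {A : Type} [Fintype A] (ρ : Matrix A A ℂ) : Prop :=
  ρ.PosSemidef ∧ ρ.trace = 1

/-- POVMs with outcome set `O`. -/
def IsPOVM {A O : Type} [Fintype O] [DecidableEq A] (P : O → Matrix A A ℂ) : Prop :=
  (∀ o, (P o).PosSemidef) ∧ ∑ o, P o = 1

/-- The behaviour of two senders who hold the two halves of the bipartite state `ρ`. On message
`m₁`, sender 1 measures the POVM `P₁ m₁` on the own half and inputs the codeword `e₁ m₁ o₁`, where
`o₁` is the outcome; likewise for sender 2. The outcomes follow the Born rule. -/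
def measuredBehaviour {n M₁ M₂ : ℕ} {A B O₁ O₂ : Type} [Fintype A] [Fintype B]
    [Fintype O₁] [Fintype O₂]
    (ρ : Matrix (A × B) (A × B) ℂ)
    (P₁ : Fin M₁ → O₁ → Matrix A A ℂ) (P₂ : Fin M₂ → O₂ → Matrix B B ℂ)
    (e₁ : Fin M₁ → O₁ → Fin n → X₁) (e₂ : Fin M₂ → O₂ → Fin n → X₂) :
    Behaviour X₁ X₂ n M₁ M₂ := fun m₁ m₂ x₁ x₂ =>
  ∑ o₁, ∑ o₂, if e₁ m₁ o₁ = x₁ ∧ e₂ m₂ o₂ = x₂ then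
    (ρ * (P₁ m₁ o₁ ⊗ₖ P₂ m₂ o₂)).trace.re else 0

/-- Entanglement-assisted strategies: for each block the senders may share any bipartite quantum
state of finite local dimensions. -/
def quantumStrategies : StrategyClass X₁ X₂ := fun n M₁ M₂ =>
  {Q | ∃ (dA dB k₁ k₂ : ℕ) (ρ : Matrix (Fin dA × Fin dB) (Fin dA × Fin dB) ℂ)
      (P₁ : Fin M₁ → Fin k₁ → Matrix (Fin dA) (Fin dA) ℂ)
      (P₂ : Fin M₂ → Fin k₂ → Matrix (Fin dB) (Fin dB) ℂ)
      (e₁ : Fin M₁ → Fin k₁ → Fin n → X₁) (e₂ : Fin M₂ → Fin k₂ → Fin n → X₂),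
      IsState ρ ∧ (∀ m, IsPOVM (P₁ m)) ∧ (∀ m, IsPOVM (P₂ m)) ∧
      Q = measuredBehaviour ρ P₁ P₂ e₁ e₂}

/-- The product of the bipartite states `σ t`, with all first halves grouped on the left and all
second halves grouped on the right. -/
def pairProduct {A B : Type} {n : ℕ} (σ : Fin n → Matrix (A × B) (A × B) ℂ) :
    Matrix ((Fin n → A) × (Fin n → B)) ((Fin n → A) × (Fin n → B)) ℂ :=
  Matrix.of fun u v => ∏ t, σ t (u.1 t, u.2 t) (v.1 t, v.2 t)

/-- Strategies assisted by `2 × d` entanglement: for each channel use the senders share one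
bipartite state of a qubit and a `d`-level system. -/
def qubitStrategies (d : ℕ) : StrategyClass X₁ X₂ := fun n M₁ M₂ =>
  {Q | ∃ (k₁ k₂ : ℕ) (σ : Fin n → Matrix (Fin 2 × Fin d) (Fin 2 × Fin d) ℂ)
      (P₁ : Fin M₁ → Fin k₁ → Matrix (Fin n → Fin 2) (Fin n → Fin 2) ℂ)
      (P₂ : Fin M₂ → Fin k₂ → Matrix (Fin n → Fin d) (Fin n → Fin d) ℂ)
      (e₁ : Fin M₁ → Fin k₁ → Fin n → X₁) (e₂ : Fin M₂ → Fin k₂ → Fin n → X₂),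
      (∀ t, IsState (σ t)) ∧ (∀ m, IsPOVM (P₁ m)) ∧ (∀ m, IsPOVM (P₂ m)) ∧
      Q = measuredBehaviour (pairProduct σ) P₁ P₂ e₁ e₂}

end Strategies

/-- The table of Channel II, with `false` for the bit 0 and `true` for the bit 1: `some (b₁, b₂)`
for the cells marked `b₁b₂/ee`, and `none` for the cells marked `ee`. -/
def channelIITable : Bool × Bool → Bool × Bool → Option (Bool × Bool)
  | (false, false), (false, false) => some (false, false)
  | (false, false), (true, false) => some (false, true)
  | (false, true), (false, true) => some (false, false)
  | (false, true), (true, true) => some (false, true)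
  | (true, false), (false, false) => some (true, false)
  | (true, false), (true, true) => some (true, true)
  | (true, true), (false, true) => some (true, false)
  | (true, true), (true, false) => some (true, true)
  | _, _ => none

/-- Transition probabilities of Channel II. An output `none` is an erased bit. -/
def channelIIProb (ε : ℝ) (x₁ x₂ : Bool × Bool) (y₁ y₂ : Option Bool) : ℝ :=
  match channelIITable x₁ x₂ with
  | none => if y₁ = none ∧ y₂ = none then 1 else 0
  | some (b₁, b₂) =>
      if y₁ = some b₁ ∧ y₂ = some b₂ then ε
      else if y₁ = none ∧ y₂ = none then 1 - ε
      else 0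

/-- Channel II with parameter `ε ∈ [0, 1]`. -/
def channelII (ε : ℝ) (hε : ε ∈ Set.Icc (0 : ℝ) 1) :
    InterferenceChannel (Bool × Bool) (Bool × Bool) (Option Bool) (Option Bool) where
  p := channelIIProb ε
  nonneg x₁ x₂ y₁ y₂ := by
    have h0 := hε.1
    have h1 := hε.2
    unfold channelIIProb
    split
    · split_ifs <;> norm_num
    · split_ifs <;> linarith
  sum_one x₁ x₂ := by
    unfold channelIIProb
    split
    · rw [Finset.sum_eq_single none, Finset.sum_eq_single none] <;> simp +contextual
    · rename_i b₁ b₂ _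
      cases b₁ <;> cases b₂ <;> simp [Fintype.sum_option]

end Interference

end

open scoped BigOperators Kronecker ComplexOrder

noncomputable section

namespace Interference

/-! Classical side. Each input of one sender wins against exactly two inputs of the other, so the
winning pairs are the edges of an 8-cycle whose antipodal vertices carry the same bit. A genie that
hands output and message of receiver 1 to receiver 2 bounds the sum rate by
$I(X_1;Y_1)+I(X_2;Y_1Y_2|X_1)$ with independent inputs (`genie_converse`). This is averaged with its
mirror image. The erased outputs contribute only $O(\varepsilon^2)$, and $\varepsilon$ times a sum
of logarithms over the edges remains (`logLik_sum_le`).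

In `eight_cycle_bound` a nonnegative Jensen term is added to that sum. The logarithms on an edge
with vertex masses $z,z'$ then merge into $3zz'\log(x^2y^2/(zz'))$, and $\log u\le u/e$ removes
$zz'$. What is left is $\frac3e\sum x_i^2x_{i+1}^2$ on the cycle, with the $x_i$ normalized in a
mixed norm: cubes added over antipodal pairs, then squares over the pairs. `cycle_form_le` bounds
the form by 2.1437, by way of a polynomial inequality in four variables. The outcome is
$1.183\,\varepsilon+2\varepsilon^2$ nats.

Quantum side. The CHSH measurements win with probability $\kappa=\cos^2(\pi/8)$ on every pair of
bits. Used once per channel use, they turn the channel into two erasure channels with common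
erasures, each of capacity $\kappa\varepsilon$. Random coding reaches that capacity (`exists_codes`,
`le_sumCapacity_of_box`), and an isometric embedding carries the qubit strategy to a $d$-level
system.

Separation. The quantum rate is $(1+\sqrt2/2)\ln 2\,\varepsilon\approx1.18328\,\varepsilon$ nats. A
classical constant of 1.255 would not lie below it; 1.183 does, narrowly, which explains the tight
numerical constants. -/

/-! ### Polynomial inequalities for the 8-cycle form -/

theorem cubic_min {ρ e x : ℝ} (hρ : 0 < ρ) (he : 0 ≤ e) (hx : 0 ≤ x) :
    -(4 * e ^ 3 / (27 * ρ ^ 2)) ≤ ρ * x ^ 3 - e * x ^ 2 := by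
  -- The minimizer is $x=2e/(3\rho)$, a double root once the minimum is subtracted.
  have h : 0 ≤ (ρ * x + e / 3) * (ρ * x - 2 * e / 3) ^ 2 := by positivity
  have h2 : 0 ≤ ((ρ * x + e / 3) * (ρ * x - 2 * e / 3) ^ 2) / ρ ^ 2 := by positivity
  have : ((ρ * x + e / 3) * (ρ * x - 2 * e / 3) ^ 2) / ρ ^ 2
      = ρ * x ^ 3 - e * x ^ 2 + 4 * e ^ 3 / (27 * ρ ^ 2) := by field_simp; ring
  linarith

theorem sextic_tail {g x : ℝ} (hx : 0 ≤ x) (hx1 : x ≤ 1) (hg : g ≤ 12.15) :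
    12.9 * x ^ 3 ≤ 19.7 * x ^ 3 - g * x ^ 4 + 5.8 * x ^ 6 := by
  have h : 0 ≤ 6.8 - 12.15 * x + 5.8 * x ^ 3 := by
    -- $(x+2r)(x-r)^2=x^3-3r^2x+2r^3$ with $r=0.835$, close to the minimizer of $5.8x^3-12.15x$.
    nlinarith [mul_nonneg (by linarith : (0:ℝ) ≤ x + 1.67) (sq_nonneg (x - 0.835))]
  nlinarith [mul_nonneg (pow_nonneg hx 3) h, mul_nonneg (pow_nonneg hx 4) (sub_nonneg.2 hg)]

/-- One-variable tail estimate. -/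
theorem quartic_tail {h β x : ℝ} (hx : 0 ≤ x) (r : ℝ) (hr : 0 ≤ r) (h1 : h ≤ 17.4 * r ^ 2)
    (h2 : 11.6 * r ^ 3 ≤ β) :
    0 ≤ β * x ^ 3 - h * x ^ 4 + 5.8 * x ^ 6 := by
  have h0 : 0 ≤ β - h * x + 5.8 * x ^ 3 := by
    nlinarith [mul_nonneg (by linarith : (0:ℝ) ≤ x + 2 * r) (sq_nonneg (x - r)),
      mul_nonneg hx (sub_nonneg.2 h1)]
  nlinarith [mul_nonneg (pow_nonneg hx 3) h0]

/-- Each power of $b$ is frozen at the unfavourable end of $[b_0,b_1]$. Then $19.7\,b_0^3d^3$ is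
split: $\beta d^3$ pays for the terms in $d^4,d^6$ by `quartic_tail`, and the rest pays for
$6.75\,d^2$ by `cubic_min`. -/
theorem two_var_interval {b d b₀ b₁ β r : ℝ} (hd : 0 ≤ d) (h0 : 0 ≤ b₀)
    (hb0 : b₀ ≤ b) (hb1 : b ≤ b₁) (hb1' : b₁ ≤ 1) (hr : 0 ≤ r)
    (h1 : 6.75 + 1.324 * b₁ ^ 8 ≤ 17.4 * r ^ 2) (h2 : 11.6 * r ^ 3 ≤ β)
    (hρ : β < 19.7 * b₀ ^ 3)
    (hK : 4 * 6.75 ^ 3 ≤ (5.4 * (1 - b₁ ^ 2) * (1 - b₁ ^ 4) + 0.4 + 0.4 * b₀ ^ 6 - 0.274 * b₁ ^ 12) * (27 * (19.7 * b₀ ^ 3 - β) ^ 2)) :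
    0 ≤ 5.4 * (1 - b ^ 2) ^ 2 * (1 + b ^ 2) + 0.4 + 0.4 * b ^ 6 - 0.274 * b ^ 12
      + 19.7 * b ^ 3 * d ^ 3 - 6.75 * d ^ 2 - (6.75 + 1.324 * b ^ 8) * d ^ 4 + 5.8 * d ^ 6 := by
  have hb : 0 ≤ b := h0.trans hb0
  have e3 : b₀ ^ 3 ≤ b ^ 3 := by gcongr
  have e6 : b₀ ^ 6 ≤ b ^ 6 := by gcongr
  have e12 : b ^ 12 ≤ b₁ ^ 12 := by gcongr
  have e8 : b ^ 8 ≤ b₁ ^ 8 := by gcongr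
  have e2 : b ^ 2 ≤ b₁ ^ 2 := by gcongr
  have e4 : b ^ 4 ≤ b₁ ^ 4 := by gcongr
  have hb1n : 0 ≤ b₁ := hb.trans hb1
  have f2 : b₁ ^ 2 ≤ 1 := pow_le_one₀ hb1n hb1'
  have f4 : b₁ ^ 4 ≤ 1 := pow_le_one₀ hb1n hb1'
  have m1 : (1 - b₁ ^ 2) * (1 - b₁ ^ 4) ≤ (1 - b ^ 2) * (1 - b ^ 4) := by
    apply mul_le_mul <;> linarith
  have t := quartic_tail (h := 6.75 + 1.324 * b ^ 8) (β := β) hd r hr (by linarith) h2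
  have c := cubic_min (ρ := 19.7 * b₀ ^ 3 - β) (e := 6.75) (by linarith) (by norm_num) hd
  have hpos : 0 < 27 * (19.7 * b₀ ^ 3 - β) ^ 2 := by
    have : 0 < 19.7 * b₀ ^ 3 - β := by linarith
    positivity
  have k : 4 * 6.75 ^ 3 / (27 * (19.7 * b₀ ^ 3 - β) ^ 2) ≤ 5.4 * (1 - b₁ ^ 2) * (1 - b₁ ^ 4) + 0.4 + 0.4 * b₀ ^ 6 - 0.274 * b₁ ^ 12 := by
    rw [div_le_iff₀ hpos]; exact hK
  have d3 : 0 ≤ d ^ 3 := by positivity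
  nlinarith [mul_nonneg d3 (sub_nonneg.2 e3)]

/-- Since $d\le b$, the term $b^3d^3$ is at least $d^6$; this leaves a cubic in $d^2$ with leading
coefficient $19.7+5.8=25.5$. -/
theorem two_var_low {b d : ℝ} (hd : 0 ≤ d) (hdb : d ≤ b) (hb : b ≤ 0.7) :
    0 ≤ 5.4 * (1 - b ^ 2) ^ 2 * (1 + b ^ 2) + 0.4 + 0.4 * b ^ 6 - 0.274 * b ^ 12
      + 19.7 * b ^ 3 * d ^ 3 - 6.75 * d ^ 2 - (6.75 + 1.324 * b ^ 8) * d ^ 4 + 5.8 * d ^ 6 := by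
  have hb0 : 0 ≤ b := hd.trans hdb
  have e3 : d ^ 3 ≤ b ^ 3 := by gcongr
  have e2 : b ^ 2 ≤ 0.49 := by nlinarith
  have e4 : b ^ 4 ≤ 0.2401 := by nlinarith
  have e8 : b ^ 8 ≤ 0.06 := by
    have : b ^ 8 = (b ^ 4) ^ 2 := by ring
    rw [this]; nlinarith [pow_nonneg hb0 4]
  have e12 : b ^ 12 ≤ 0.0145 := by nlinarith [mul_le_mul e8 e4 (by positivity) (by norm_num)]
  have e6 : 0 ≤ b ^ 6 := by positivity
  have m1 : (1 - 0.49) * (1 - 0.2401) ≤ (1 - b ^ 2) * (1 - b ^ 4) := by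
    apply mul_le_mul <;> linarith
  have d3 : 0 ≤ d ^ 3 := by positivity
  have d4 : 0 ≤ d ^ 4 := by positivity
  have d2 : 0 ≤ d ^ 2 := by positivity
  have key : 0 ≤ 2.48 - 6.75 * d ^ 2 - 6.83 * (d ^ 2) ^ 2 + 25.5 * (d ^ 2) ^ 3 := by
    nlinarith [mul_nonneg (by linarith : (0:ℝ) ≤ d ^ 2 + 0.5) (sq_nonneg (d ^ 2 - 0.4)), sq_nonneg (d ^ 2 - 0.4)]
  nlinarith [mul_nonneg d3 (sub_nonneg.2 e3), mul_nonneg d4 (sub_nonneg.2 e8)]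

/-- Reduction to one variable on a short interval; 6.98 exceeds $6.75+1.324\cdot0.8^8$. -/
theorem two_var_mid {b d b₀ b₁ K α : ℝ} (hd : 0 ≤ d) (hdb : d ≤ b) (h0 : 0 ≤ b₀)
    (hb0 : b₀ ≤ b) (hb1 : b ≤ b₁) (hb1' : b₁ ≤ 0.8)
    (hα : α ≤ 19.7 * b₀ ^ 3)
    (hK : K ≤ 5.4 * (1 - b₁ ^ 2) * (1 - b₁ ^ 4) + 0.4 + 0.4 * b₀ ^ 6 - 0.274 * b₁ ^ 12)
    (hp : ∀ x : ℝ, 0 ≤ x → x ≤ b₁ → 0 ≤ K + α * x ^ 3 - 6.75 * x ^ 2 - 6.98 * x ^ 4 + 5.8 * x ^ 6) :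
    0 ≤ 5.4 * (1 - b ^ 2) ^ 2 * (1 + b ^ 2) + 0.4 + 0.4 * b ^ 6 - 0.274 * b ^ 12
      + 19.7 * b ^ 3 * d ^ 3 - 6.75 * d ^ 2 - (6.75 + 1.324 * b ^ 8) * d ^ 4 + 5.8 * d ^ 6 := by
  have hb : 0 ≤ b := h0.trans hb0
  have e3 : b₀ ^ 3 ≤ b ^ 3 := by gcongr
  have e6 : b₀ ^ 6 ≤ b ^ 6 := by gcongr
  have e12 : b ^ 12 ≤ b₁ ^ 12 := by gcongr
  have e8 : b ^ 8 ≤ 0.8 ^ 8 := by gcongr; linarith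
  have e2 : b ^ 2 ≤ b₁ ^ 2 := by gcongr
  have e4 : b ^ 4 ≤ b₁ ^ 4 := by gcongr
  have hb1n : 0 ≤ b₁ := hb.trans hb1
  have f2 : b₁ ^ 2 ≤ 1 := pow_le_one₀ hb1n (by linarith)
  have f4 : b₁ ^ 4 ≤ 1 := pow_le_one₀ hb1n (by linarith)
  have m1 : (1 - b₁ ^ 2) * (1 - b₁ ^ 4) ≤ (1 - b ^ 2) * (1 - b ^ 4) := by
    apply mul_le_mul <;> linarith
  have d3 : 0 ≤ d ^ 3 := by positivity
  have d4 : 0 ≤ d ^ 4 := by positivity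
  have := hp d hd (hdb.trans hb1)
  norm_num at e8
  nlinarith [mul_nonneg d3 (sub_nonneg.2 e3), mul_nonneg d4 (sub_nonneg.2 e8), mul_nonneg d3 (sub_nonneg.2 hα)]

theorem two_var_poly {b d : ℝ} (hd : 0 ≤ d) (hdb : d ≤ b) (hb : b ≤ 1) :
    0 ≤ 5.4 * (1 - b ^ 2) ^ 2 * (1 + b ^ 2) + 0.4 + 0.4 * b ^ 6 - 0.274 * b ^ 12
      + 19.7 * b ^ 3 * d ^ 3 - 6.75 * d ^ 2 - (6.75 + 1.324 * b ^ 8) * d ^ 4 + 5.8 * d ^ 6 := by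
  rcases le_total b 0.7 with h | h
  · exact two_var_low hd hdb h
  rcases le_total b 0.725 with h' | h'
  · refine two_var_mid (K := 2.29) (α := 6.75) hd hdb (by norm_num) h h' (by norm_num) (by norm_num) (by norm_num) ?_
    intro x hx hx1
    have hX : x ^ 2 ≤ 0.725 ^ 2 := by gcongr
    -- On this range the quartic and sextic terms together cost at most $2.07\,x^2$, so `cubic_min`
    -- is applied with $e=6.75+2.07$.
    have hk : 6.98 * x ^ 2 - 5.8 * (x ^ 2) ^ 2 ≤ 2.07 := by nlinarith [sq_nonneg x]
    have := cubic_min (ρ := 6.75) (e := 8.82) (by norm_num) (by norm_num) hx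
    norm_num at this
    nlinarith [mul_nonneg (sq_nonneg x) (sub_nonneg.2 hk)]
  rcases le_total b 0.75 with h'' | h''
  · refine two_var_mid (K := 2.06) (α := 7.5) hd hdb (by norm_num) h' h'' (by norm_num) (by norm_num) (by norm_num) ?_
    intro x hx hx1
    have hX : x ^ 2 ≤ 0.75 ^ 2 := by gcongr
    have hk : 6.98 * x ^ 2 - 5.8 * (x ^ 2) ^ 2 ≤ 2.1 := by nlinarith [sq_nonneg x]
    have := cubic_min (ρ := 7.5) (e := 8.85) (by norm_num) (by norm_num) hx
    norm_num at this
    nlinarith [mul_nonneg (sq_nonneg x) (sub_nonneg.2 hk)]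
  rcases le_total b 0.775 with h3 | h3
  · exact two_var_interval (r := 0.632) (β := 2.94) hd (b₀ := 0.75) (b₁ := 0.775) (by norm_num) h'' h3 (by norm_num) (by norm_num) (by norm_num) (by norm_num) (by norm_num) (by norm_num)
  rcases le_total b 0.8 with h4 | h4
  · exact two_var_interval (r := 0.64) (β := 3.05) hd (b₀ := 0.775) (b₁ := 0.8) (by norm_num) h3 h4 (by norm_num) (by norm_num) (by norm_num) (by norm_num) (by norm_num) (by norm_num)
  rcases le_total b 0.85 with h5 | h5
  · exact two_var_interval (r := 0.65) (β := 3.19) hd (b₀ := 0.8) (b₁ := 0.85) (by norm_num) h4 h5 (by norm_num) (by norm_num) (by norm_num) (by norm_num) (by norm_num) (by norm_num)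
  rcases le_total b 0.9 with h6 | h6
  · exact two_var_interval (r := 0.682) (β := 3.68) hd (b₀ := 0.85) (b₁ := 0.9) (by norm_num) h5 h6 (by norm_num) (by norm_num) (by norm_num) (by norm_num) (by norm_num) (by norm_num)
  rcases le_total b 0.95 with h7 | h7
  · exact two_var_interval (r := 0.682) (β := 3.68) hd (b₀ := 0.9) (b₁ := 0.95) (by norm_num) h6 h7 (by norm_num) (by norm_num) (by norm_num) (by norm_num) (by norm_num) (by norm_num)
  · exact two_var_interval (r := 0.682) (β := 3.68) hd (b₀ := 0.95) (b₁ := 1) (by norm_num) h7 hb (by norm_num) (by norm_num) (by norm_num) (by norm_num) (by norm_num) (by norm_num)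

/-- The variable $c$ enters the difference of the two sides through
$19.7c^3-(6.75b^4+5.4d^4)c^2-(6.75b^2+5.4d^2)c^4+5.8c^6$. Bounding this from below over $c$ leaves
the polynomial of `two_var_poly`. -/
theorem four_var_poly_one {b c d : ℝ} (hc : 0 ≤ c) (hc1 : c ≤ 1) (hd : 0 ≤ d) (hdb : d ≤ b)
    (hb : b ≤ 1) :
    9 / 5 * ((1 + b ^ 2) ^ 3 + (c ^ 2 + d ^ 2) ^ 3)
      + 9 / 4 * ((b ^ 2 + c ^ 2) ^ 3 + (d ^ 2 + 1) ^ 3)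
      ≤ 9.85 * ((1 + c ^ 3) ^ 2 + (b ^ 3 + d ^ 3) ^ 2) := by
  have h := two_var_poly hd hdb hb
  have hb0 : 0 ≤ b := hd.trans hdb
  have hB : b ^ 2 ≤ 1 := pow_le_one₀ hb0 hb
  have hDB : d ^ 2 ≤ b ^ 2 := by gcongr
  have hD0 : 0 ≤ d ^ 2 := by positivity
  have t1 := sextic_tail (g := 6.75 * b ^ 2 + 5.4 * d ^ 2) hc hc1 (by linarith)
  have he : 0 ≤ 6.75 * b ^ 4 + 5.4 * d ^ 4 := by positivity
  have t2 := cubic_min (ρ := 12.9) (e := 6.75 * b ^ 4 + 5.4 * d ^ 4) (by norm_num) he hc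
  have hD4 : d ^ 4 ≤ b ^ 4 := by gcongr
  -- The cube is convex in $d^4\in[0,b^4]$ and so lies below its chord: $6.75^3\le307.6$ and
  -- $12.15^3-6.75^3\le1486.1$.
  have e3 : (6.75 * b ^ 4 + 5.4 * d ^ 4) ^ 3 ≤ 307.6 * b ^ 12 + 1486.1 * d ^ 4 * b ^ 8 := by
    have hd4 : 0 ≤ d ^ 4 := by positivity
    generalize d ^ 4 = y at *
    have e12 : b ^ 12 = (b ^ 4) ^ 3 := by ring
    have e8 : b ^ 8 = (b ^ 4) ^ 2 := by ring
    rw [e12, e8]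
    have hx : 0 ≤ b ^ 4 := by positivity
    generalize b ^ 4 = x at *
    nlinarith [mul_nonneg hd4 (mul_nonneg hx (sub_nonneg.2 hD4)), pow_nonneg hx 3,
      mul_nonneg (mul_nonneg hd4 hd4) (sub_nonneg.2 hD4), mul_nonneg hd4 (pow_nonneg hx 2)]
  have e3' : 4 * (6.75 * b ^ 4 + 5.4 * d ^ 4) ^ 3 / (27 * 12.9 ^ 2)
      ≤ 0.274 * b ^ 12 + 1.324 * b ^ 8 * d ^ 4 := by
    rw [div_le_iff₀ (by norm_num)]
    have : 0 ≤ b ^ 12 := by positivity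
    have : 0 ≤ d ^ 4 * b ^ 8 := by positivity
    nlinarith
  nlinarith [pow_nonneg hc 6, pow_nonneg hd 6, pow_nonneg hb0 6]

theorem four_var_poly_of_le {a b c d : ℝ} (hc : 0 ≤ c) (hca : c ≤ a) (hd : 0 ≤ d) (hdb : d ≤ b)
    (hba : b ≤ a) :
    9 / 5 * ((a ^ 2 + b ^ 2) ^ 3 + (c ^ 2 + d ^ 2) ^ 3)
      + 9 / 4 * ((b ^ 2 + c ^ 2) ^ 3 + (d ^ 2 + a ^ 2) ^ 3)
      ≤ 9.85 * ((a ^ 3 + c ^ 3) ^ 2 + (b ^ 3 + d ^ 3) ^ 2) := by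
  rcases (hc.trans hca).eq_or_lt with ha | ha
  · have : c = 0 := by linarith
    have : b = 0 := by linarith
    have : d = 0 := by linarith
    subst_vars; norm_num
  -- Both sides are homogeneous of degree 6.
  have h := four_var_poly_one (b := b / a) (c := c / a) (d := d / a) (by positivity)
    ((div_le_one ha).2 hca) (by positivity) (by gcongr) ((div_le_one ha).2 hba)
  have h' := mul_le_mul_of_nonneg_left h (pow_nonneg ha.le 6)
  have eb : b = a * (b / a) := by field_simp
  have ec : c = a * (c / a) := by field_simp
  have ed : d = a * (d / a) := by field_simp
  generalize b / a = b' at *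
  generalize c / a = c' at *
  generalize d / a = d' at *
  subst eb ec ed
  linarith

/-- The sextic form behind the norm of the adjacency matrix of the 8-cycle. -/
theorem four_var_poly {a b c d : ℝ} (hc : 0 ≤ c) (hca : c ≤ a) (hd : 0 ≤ d) (hdb : d ≤ b) :
    9 / 5 * ((a ^ 2 + b ^ 2) ^ 3 + (c ^ 2 + d ^ 2) ^ 3)
      + 9 / 4 * ((b ^ 2 + c ^ 2) ^ 3 + (d ^ 2 + a ^ 2) ^ 3)
      ≤ 9.85 * ((a ^ 3 + c ^ 3) ^ 2 + (b ^ 3 + d ^ 3) ^ 2) := by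
  rcases le_total b a with h | h
  · exact four_var_poly_of_le hc hca hd hdb h
  -- A reflection of the cycle exchanges $(a,c)$ and $(b,d)$.
  · have := four_var_poly_of_le hd hdb hc hca h
    linarith

theorem weighted_amgm {y z l : ℝ} (hy : 0 ≤ y) (hz : 0 ≤ z) (hl : 0 < l) :
    y ^ 2 * z ≤ 2 / 3 * l * y ^ 3 + z ^ 3 / (3 * l ^ 2) := by
  have h : 0 ≤ ((2 * l * y + z) * (l * y - z) ^ 2) / (3 * l ^ 2) := by positivity
  have : ((2 * l * y + z) * (l * y - z) ^ 2) / (3 * l ^ 2)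
      = 2 / 3 * l * y ^ 3 + z ^ 3 / (3 * l ^ 2) - y ^ 2 * z := by field_simp; ring
  linarith

/-- Weighted AM-GM separates the odd coordinates from the even ones. The odd part is closed by
Cauchy–Schwarz, as $l^2+k^2=2.1437^2$, and the even part by `four_var_poly`, as $9.85\le2.1437^3$.
The ratio $l^2:k^2=5:4$ produces the coefficients 9/5 and 9/4. -/
theorem cycle_form_aux {a b c d p q r s : ℝ} (hc : 0 ≤ c) (hca : c ≤ a) (hd : 0 ≤ d) (hdb : d ≤ b)
    (hp : 0 ≤ p) (hq : 0 ≤ q) (hr : 0 ≤ r) (hs : 0 ≤ s)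
    (hx : (a ^ 3 + c ^ 3) ^ 2 + (b ^ 3 + d ^ 3) ^ 2 = 1)
    (hy : (p ^ 3 + r ^ 3) ^ 2 + (q ^ 3 + s ^ 3) ^ 2 = 1) :
    p ^ 2 * (a ^ 2 + b ^ 2) + q ^ 2 * (b ^ 2 + c ^ 2) + r ^ 2 * (c ^ 2 + d ^ 2)
      + s ^ 2 * (d ^ 2 + a ^ 2) ≤ 2.1437 := by
  have h := four_var_poly hc hca hd hdb
  rw [hx] at h
  set l : ℝ := Real.sqrt 5 / 3 * 2.1437 with hl
  set k : ℝ := 2 / 3 * 2.1437 with hk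
  have h5 : Real.sqrt 5 ^ 2 = 5 := Real.sq_sqrt (by norm_num)
  have h5p : 0 < Real.sqrt 5 := by positivity
  have hlp : 0 < l := by positivity
  have hkp : 0 < k := by positivity
  have l2 : l ^ 2 = 5 / 9 * 2.1437 ^ 2 := by rw [hl, mul_pow, div_pow, h5]; norm_num
  have k2 : k ^ 2 = 4 / 9 * 2.1437 ^ 2 := by rw [hk]; norm_num
  have i1 := weighted_amgm hp (by positivity : 0 ≤ a ^ 2 + b ^ 2) hlp
  have i2 := weighted_amgm hq (by positivity : 0 ≤ b ^ 2 + c ^ 2) hkp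
  have i3 := weighted_amgm hr (by positivity : 0 ≤ c ^ 2 + d ^ 2) hlp
  have i4 := weighted_amgm hs (by positivity : 0 ≤ d ^ 2 + a ^ 2) hkp
  have cs : l * (p ^ 3 + r ^ 3) + k * (q ^ 3 + s ^ 3) ≤ 2.1437 := by
    apply le_of_sq_le_sq _ (by norm_num)
    have e : (l * (p ^ 3 + r ^ 3) + k * (q ^ 3 + s ^ 3)) ^ 2
        + (l * (q ^ 3 + s ^ 3) - k * (p ^ 3 + r ^ 3)) ^ 2
        = (l ^ 2 + k ^ 2) * ((p ^ 3 + r ^ 3) ^ 2 + (q ^ 3 + s ^ 3) ^ 2) := by ring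
    rw [hy, l2, k2] at e
    refine (le_add_of_nonneg_right (sq_nonneg _)).trans (e.le.trans ?_)
    norm_num
  rw [l2] at i1 i3
  rw [k2] at i2 i4
  have e1 : ∀ z : ℝ, z / (3 * (5 / 9 * 2.1437 ^ 2)) = z * (9 / 5) / (3 * 2.1437 ^ 2) := by
    intro z; field_simp
  have e2 : ∀ z : ℝ, z / (3 * (4 / 9 * 2.1437 ^ 2)) = z * (9 / 4) / (3 * 2.1437 ^ 2) := by
    intro z; field_simp
  rw [e1] at i1 i3
  rw [e2] at i2 i4
  norm_num at i1 i2 i3 i4 h cs ⊢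
  linarith

/-- The bilinear form of the 8-cycle, in coordinates normalized in the mixed norm. -/
theorem cycle_form_le {a b c d p q r s : ℝ} (ha : 0 ≤ a) (hb : 0 ≤ b) (hc : 0 ≤ c) (hd : 0 ≤ d)
    (hp : 0 ≤ p) (hq : 0 ≤ q) (hr : 0 ≤ r) (hs : 0 ≤ s)
    (hx : (a ^ 3 + c ^ 3) ^ 2 + (b ^ 3 + d ^ 3) ^ 2 = 1)
    (hy : (p ^ 3 + r ^ 3) ^ 2 + (q ^ 3 + s ^ 3) ^ 2 = 1) :
    p ^ 2 * (a ^ 2 + b ^ 2) + q ^ 2 * (b ^ 2 + c ^ 2) + r ^ 2 * (c ^ 2 + d ^ 2)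
      + s ^ 2 * (d ^ 2 + a ^ 2) ≤ 2.1437 := by
  -- A rotation of the cycle brings the larger member of each even antipodal pair to $a$ and $b$.
  rcases le_total c a with h1 | h1 <;> rcases le_total d b with h2 | h2
  · exact cycle_form_aux hc h1 hd h2 hp hq hr hs hx hy
  · have := cycle_form_aux hb h2 hc h1 hs hp hq hr (by linarith) (by linarith)
    linarith
  · have := cycle_form_aux hd h2 ha h1 hq hr hs hp (by linarith) (by linarith)
    linarith
  · have := cycle_form_aux ha h1 hb h2 hr hs hp hq (by linarith) (by linarith)
    linarith

/-! ### The entropy estimate on the 8-cycle -/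

theorem log_le_div_exp_one {u : ℝ} (hu : 0 < u) : Real.log u ≤ u / Real.exp 1 := by
  have h := Real.log_le_sub_one_of_pos (div_pos hu (Real.exp_pos 1))
  rw [Real.log_div hu.ne' (Real.exp_pos 1).ne', Real.log_exp] at h
  linarith

theorem sub_le_mul_log_div {x y : ℝ} (hx : 0 ≤ x) (hy : 0 ≤ y) (hxy : y = 0 → x = 0) :
    x - y ≤ x * Real.log (x / y) := by
  rcases hx.eq_or_lt with rfl | hx
  · simpa using hy
  · have hy : 0 < y := lt_of_le_of_ne hy fun h => hx.ne' (hxy h.symm)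
    have h := Real.log_le_sub_one_of_pos (div_pos hy hx)
    have e : Real.log (x / y) = -Real.log (y / x) := by rw [← Real.log_inv, inv_div]
    have : x * (y / x) = y := by field_simp
    rw [e]
    nlinarith

/-- The cube root of `v / √(Q w)`. -/
def cbrtWeight (v Q w : ℝ) : ℝ := (v / Real.sqrt (Q * w)) ^ (1 / 3 : ℝ)

theorem cbrtWeight_nonneg {v Q w : ℝ} (hv : 0 ≤ v) : 0 ≤ cbrtWeight v Q w := by
  unfold cbrtWeight; positivity

theorem cbrtWeight_cube {v Q w : ℝ} (hv : 0 ≤ v) :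
    cbrtWeight v Q w ^ 3 = v / Real.sqrt (Q * w) := by
  unfold cbrtWeight
  rw [← Real.rpow_natCast, ← Real.rpow_mul (by positivity)]
  norm_num

theorem cbrtWeight_pair {v v' w : ℝ} (hv : 0 ≤ v) (hv' : 0 ≤ v') (hw : 0 < w) :
    (cbrtWeight v (v + v') w ^ 3 + cbrtWeight v' (v + v') w ^ 3) ^ 2 = (v + v') / w := by
  rw [cbrtWeight_cube hv, cbrtWeight_cube hv', ← add_div, div_pow, Real.sq_sqrt (by positivity)]
  rcases (add_nonneg hv hv').eq_or_lt with h | h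
  · rw [← h]; simp
  · field_simp

/-- The four logarithms add up to $3\log(x^2y^2/(zz'))$, where $x,y$ are the two weights: the powers
of $A,A',Q,Q',w$ match because $x^6=z^2A^2/(Qw)$, and likewise for $y$. Then $\log u\le u/e$ cancels
the factor $zz'$. -/
theorem edge_bound {z z' A A' Q Q' w : ℝ} (hz : 0 ≤ z) (hz' : 0 ≤ z') (hA : z' ≤ A) (hA' : z ≤ A')
    (hQ : z * A ≤ Q) (hQ' : z' * A' ≤ Q') (hw : 0 < w) :
    z * z' * (Real.log (A / (Q * z')) + Real.log (A' / (Q' * z)))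
      + z * z' * (Real.log (A / w) + Real.log (A' / w))
      ≤ 3 / Real.exp 1 *
        (cbrtWeight (z * A) Q w ^ 2 * cbrtWeight (z' * A') Q' w ^ 2) := by
  rcases hz.eq_or_lt with rfl | hz
  · simp only [zero_mul, zero_add]; positivity
  rcases hz'.eq_or_lt with rfl | hz'
  · simp only [zero_mul, mul_zero, zero_add]; positivity
  have hA0 : 0 < A := hz'.trans_le hA
  have hA0' : 0 < A' := hz.trans_le hA'
  have hQ0 : 0 < Q := (mul_pos hz hA0).trans_le hQ
  have hQ0' : 0 < Q' := (mul_pos hz' hA0').trans_le hQ'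
  set x := cbrtWeight (z * A) Q w with hx
  set y := cbrtWeight (z' * A') Q' w with hy
  have cx : x ^ 3 = z * A / Real.sqrt (Q * w) := cbrtWeight_cube (by positivity)
  have cy : y ^ 3 = z' * A' / Real.sqrt (Q' * w) := cbrtWeight_cube (by positivity)
  have x0 : 0 < x := Real.rpow_pos_of_pos (by positivity) _
  have y0 : 0 < y := Real.rpow_pos_of_pos (by positivity) _
  have x6 : x ^ 6 = z ^ 2 * A ^ 2 / (Q * w) := by
    rw [show x ^ 6 = (x ^ 3) ^ 2 by ring, cx, div_pow, Real.sq_sqrt (by positivity)]; ring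
  have y6 : y ^ 6 = z' ^ 2 * A' ^ 2 / (Q' * w) := by
    rw [show y ^ 6 = (y ^ 3) ^ 2 by ring, cy, div_pow, Real.sq_sqrt (by positivity)]; ring
  have e : Real.log (A / (Q * z')) + Real.log (A' / (Q' * z))
      + (Real.log (A / w) + Real.log (A' / w)) = 3 * Real.log (x ^ 2 * y ^ 2 / (z * z')) := by
    rw [← Real.log_mul (by positivity) (by positivity), ← Real.log_mul (by positivity) (by positivity),
      ← Real.log_mul (by positivity) (by positivity)]
    rw [show (3 : ℝ) = ((3 : ℕ) : ℝ) by norm_num, ← Real.log_pow]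
    congr 1
    have : (x ^ 2 * y ^ 2 / (z * z')) ^ 3 = x ^ 6 * y ^ 6 / (z * z') ^ 3 := by ring
    rw [this, x6, y6]
    field_simp
  have l := log_le_div_exp_one (u := x ^ 2 * y ^ 2 / (z * z')) (by positivity)
  rw [← mul_add, e]
  have := mul_le_mul_of_nonneg_left l (by positivity : 0 ≤ 3 * (z * z'))
  have e2 : 3 * (z * z') * (x ^ 2 * y ^ 2 / (z * z') / Real.exp 1)
      = 3 / Real.exp 1 * (x ^ 2 * y ^ 2) := by
    have := (Real.exp_pos 1).ne'
    field_simp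
  linarith

theorem jensen_term {z A w : ℝ} (hz : 0 ≤ z) (hA : 0 ≤ A) (hw : 0 < w) :
    z * (A - w) ≤ z * (A * Real.log (A / w)) :=
  mul_le_mul_of_nonneg_left (sub_le_mul_log_div hA hw.le fun h => absurd h hw.ne') hz

/-- The single-letter estimate: two product distributions, on the even and on the odd vertices
of the 8-cycle. -/
theorem eight_cycle_bound {z₀ z₁ z₂ z₃ z₄ z₅ z₆ z₇ : ℝ}
    (h₀ : 0 ≤ z₀) (h₁ : 0 ≤ z₁) (h₂ : 0 ≤ z₂) (h₃ : 0 ≤ z₃)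
    (h₄ : 0 ≤ z₄) (h₅ : 0 ≤ z₅) (h₆ : 0 ≤ z₆) (h₇ : 0 ≤ z₇)
    (he : z₀ + z₂ + z₄ + z₆ = 1) (ho : z₁ + z₃ + z₅ + z₇ = 1)
    {A₀ A₁ A₂ A₃ A₄ A₅ A₆ A₇ Q₀ Q₁ Q₂ Q₃ : ℝ}
    (a₀ : A₀ = z₇ + z₁) (a₁ : A₁ = z₀ + z₂) (a₂ : A₂ = z₁ + z₃) (a₃ : A₃ = z₂ + z₄)
    (a₄ : A₄ = z₃ + z₅) (a₅ : A₅ = z₄ + z₆) (a₆ : A₆ = z₅ + z₇) (a₇ : A₇ = z₆ + z₀)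
    (q₀ : Q₀ = z₀ * A₀ + z₄ * A₄) (q₁ : Q₁ = z₁ * A₁ + z₅ * A₅)
    (q₂ : Q₂ = z₂ * A₂ + z₆ * A₆) (q₃ : Q₃ = z₃ * A₃ + z₇ * A₇) :
    z₀ * z₁ * (Real.log (A₀ / (Q₀ * z₁)) + Real.log (A₁ / (Q₁ * z₀)))
    + z₁ * z₂ * (Real.log (A₁ / (Q₁ * z₂)) + Real.log (A₂ / (Q₂ * z₁)))
    + z₂ * z₃ * (Real.log (A₂ / (Q₂ * z₃)) + Real.log (A₃ / (Q₃ * z₂)))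
    + z₃ * z₄ * (Real.log (A₃ / (Q₃ * z₄)) + Real.log (A₄ / (Q₀ * z₃)))
    + z₄ * z₅ * (Real.log (A₄ / (Q₀ * z₅)) + Real.log (A₅ / (Q₁ * z₄)))
    + z₅ * z₆ * (Real.log (A₅ / (Q₁ * z₆)) + Real.log (A₆ / (Q₂ * z₅)))
    + z₆ * z₇ * (Real.log (A₆ / (Q₂ * z₇)) + Real.log (A₇ / (Q₃ * z₆)))
    + z₇ * z₀ * (Real.log (A₇ / (Q₃ * z₀)) + Real.log (A₀ / (Q₀ * z₇))) ≤ 2 * 1.183 := by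
  set w := z₀ * A₀ + z₂ * A₂ + z₄ * A₄ + z₆ * A₆ with hw
  have A0 : 0 ≤ A₀ := by linarith
  have A1 : 0 ≤ A₁ := by linarith
  have A2 : 0 ≤ A₂ := by linarith
  have A3 : 0 ≤ A₃ := by linarith
  have A4 : 0 ≤ A₄ := by linarith
  have A5 : 0 ≤ A₅ := by linarith
  have A6 : 0 ≤ A₆ := by linarith
  have A7 : 0 ≤ A₇ := by linarith
  have v0 : 0 ≤ z₀ * A₀ := by positivity
  have v1 : 0 ≤ z₁ * A₁ := by positivity
  have v2 : 0 ≤ z₂ * A₂ := by positivity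
  have v3 : 0 ≤ z₃ * A₃ := by positivity
  have v4 : 0 ≤ z₄ * A₄ := by positivity
  have v5 : 0 ≤ z₅ * A₅ := by positivity
  have v6 : 0 ≤ z₆ * A₆ := by positivity
  have v7 : 0 ≤ z₇ * A₇ := by positivity
  have hw' : w = z₁ * A₁ + z₃ * A₃ + z₅ * A₅ + z₇ * A₇ := by rw [hw]; subst_vars; ring
  have hwe : w = z₀ * z₁ + z₁ * z₂ + z₂ * z₃ + z₃ * z₄ + z₄ * z₅ + z₅ * z₆ + z₆ * z₇ + z₇ * z₀ := by
    rw [hw]; subst_vars; ring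
  have w0 : 0 ≤ w := by positivity
  -- For $w=0$ no edge carries mass and every term vanishes.
  rcases w0.eq_or_lt with w0 | w0
  · have p1 : 0 ≤ z₀ * z₁ := by positivity
    have p2 : 0 ≤ z₁ * z₂ := by positivity
    have p3 : 0 ≤ z₂ * z₃ := by positivity
    have p4 : 0 ≤ z₃ * z₄ := by positivity
    have p5 : 0 ≤ z₄ * z₅ := by positivity
    have p6 : 0 ≤ z₅ * z₆ := by positivity
    have p7 : 0 ≤ z₆ * z₇ := by positivity
    have p8 : 0 ≤ z₇ * z₀ := by positivity
    rw [show z₀ * z₁ = 0 by linarith, show z₁ * z₂ = 0 by linarith, show z₂ * z₃ = 0 by linarith,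
      show z₃ * z₄ = 0 by linarith, show z₄ * z₅ = 0 by linarith, show z₅ * z₆ = 0 by linarith,
      show z₆ * z₇ = 0 by linarith, show z₇ * z₀ = 0 by linarith]
    norm_num
  have b1 := edge_bound (A := A₀) (A' := A₁) (Q := Q₀) (Q' := Q₁) h₀ h₁ (by linarith) (by linarith) (by linarith) (by linarith) w0
  have b2 := edge_bound (A := A₁) (A' := A₂) (Q := Q₁) (Q' := Q₂) h₁ h₂ (by linarith) (by linarith) (by linarith) (by linarith) w0
  have b3 := edge_bound (A := A₂) (A' := A₃) (Q := Q₂) (Q' := Q₃) h₂ h₃ (by linarith) (by linarith) (by linarith) (by linarith) w0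
  have b4 := edge_bound (A := A₃) (A' := A₄) (Q := Q₃) (Q' := Q₀) h₃ h₄ (by linarith) (by linarith) (by linarith) (by linarith) w0
  have b5 := edge_bound (A := A₄) (A' := A₅) (Q := Q₀) (Q' := Q₁) h₄ h₅ (by linarith) (by linarith) (by linarith) (by linarith) w0
  have b6 := edge_bound (A := A₅) (A' := A₆) (Q := Q₁) (Q' := Q₂) h₅ h₆ (by linarith) (by linarith) (by linarith) (by linarith) w0
  have b7 := edge_bound (A := A₆) (A' := A₇) (Q := Q₂) (Q' := Q₃) h₆ h₇ (by linarith) (by linarith) (by linarith) (by linarith) w0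
  have b8 := edge_bound (A := A₇) (A' := A₀) (Q := Q₃) (Q' := Q₀) h₇ h₀ (by linarith) (by linarith) (by linarith) (by linarith) w0
  have j0 := jensen_term h₀ A0 w0
  have j1 := jensen_term h₁ A1 w0
  have j2 := jensen_term h₂ A2 w0
  have j3 := jensen_term h₃ A3 w0
  have j4 := jensen_term h₄ A4 w0
  have j5 := jensen_term h₅ A5 w0
  have j6 := jensen_term h₆ A6 w0
  have j7 := jensen_term h₇ A7 w0
  have jen : 0 ≤ z₀ * z₁ * (Real.log (A₀ / w) + Real.log (A₁ / w))
    + z₁ * z₂ * (Real.log (A₁ / w) + Real.log (A₂ / w))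
    + z₂ * z₃ * (Real.log (A₂ / w) + Real.log (A₃ / w))
    + z₃ * z₄ * (Real.log (A₃ / w) + Real.log (A₄ / w))
    + z₄ * z₅ * (Real.log (A₄ / w) + Real.log (A₅ / w))
    + z₅ * z₆ * (Real.log (A₅ / w) + Real.log (A₆ / w))
    + z₆ * z₇ * (Real.log (A₆ / w) + Real.log (A₇ / w))
    + z₇ * z₀ * (Real.log (A₇ / w) + Real.log (A₀ / w)) := by
    -- Even and odd vertices each have total mass 1, and $\sum zA=w$ on either class, so the linear
    -- lower bounds of `jensen_term` cancel in total.
    have s : z₀ * (A₀ - w) + z₁ * (A₁ - w) + z₂ * (A₂ - w) + z₃ * (A₃ - w) + z₄ * (A₄ - w)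
      + z₅ * (A₅ - w) + z₆ * (A₆ - w) + z₇ * (A₇ - w) = 0 := by
      have : z₀ * (A₀ - w) + z₁ * (A₁ - w) + z₂ * (A₂ - w) + z₃ * (A₃ - w) + z₄ * (A₄ - w)
        + z₅ * (A₅ - w) + z₆ * (A₆ - w) + z₇ * (A₇ - w)
        = (z₀ * A₀ + z₂ * A₂ + z₄ * A₄ + z₆ * A₆) + (z₁ * A₁ + z₃ * A₃ + z₅ * A₅ + z₇ * A₇)
          - (z₀ + z₂ + z₄ + z₆) * w - (z₁ + z₃ + z₅ + z₇) * w := by ring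
      rw [this, he, ho, ← hw', ← hw]; ring
    generalize Real.log (A₀ / w) = l0 at *
    generalize Real.log (A₁ / w) = l1 at *
    generalize Real.log (A₂ / w) = l2 at *
    generalize Real.log (A₃ / w) = l3 at *
    generalize Real.log (A₄ / w) = l4 at *
    generalize Real.log (A₅ / w) = l5 at *
    generalize Real.log (A₆ / w) = l6 at *
    generalize Real.log (A₇ / w) = l7 at *
    have e : z₀ * (A₀ * l0) + z₁ * (A₁ * l1) + z₂ * (A₂ * l2) + z₃ * (A₃ * l3) + z₄ * (A₄ * l4)
      + z₅ * (A₅ * l5) + z₆ * (A₆ * l6) + z₇ * (A₇ * l7) = z₀ * z₁ * (l0 + l1)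
    + z₁ * z₂ * (l1 + l2) + z₂ * z₃ * (l2 + l3) + z₃ * z₄ * (l3 + l4) + z₄ * z₅ * (l4 + l5)
    + z₅ * z₆ * (l5 + l6) + z₆ * z₇ * (l6 + l7) + z₇ * z₀ * (l7 + l0) := by
      rw [a₀, a₁, a₂, a₃, a₄, a₅, a₆, a₇]; ring
    linarith
  have c0 := cbrtWeight_pair v0 v4 w0
  have c1 := cbrtWeight_pair v1 v5 w0
  have c2 := cbrtWeight_pair v2 v6 w0
  have c3 := cbrtWeight_pair v3 v7 w0
  rw [← q₀] at c0
  rw [← q₁] at c1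
  rw [← q₂] at c2
  rw [← q₃] at c3
  have key := cycle_form_le
    (cbrtWeight_nonneg (Q := Q₀) (w := w) v0) (cbrtWeight_nonneg (Q := Q₂) (w := w) v2)
    (cbrtWeight_nonneg (Q := Q₀) (w := w) v4) (cbrtWeight_nonneg (Q := Q₂) (w := w) v6)
    (cbrtWeight_nonneg (Q := Q₁) (w := w) v1) (cbrtWeight_nonneg (Q := Q₃) (w := w) v3)
    (cbrtWeight_nonneg (Q := Q₁) (w := w) v5) (cbrtWeight_nonneg (Q := Q₃) (w := w) v7)
    (by rw [c0, c2, ← add_div, div_eq_one_iff_eq w0.ne', q₀, q₂, hw]; ring)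
    (by rw [c1, c3, ← add_div, div_eq_one_iff_eq w0.ne', q₁, q₃, hw']; ring)
  -- $3\cdot2.1437/e\approx2.3659<2.366$.
  have hE : 3 / Real.exp 1 * 2.1437 ≤ 2 * 1.183 := by
    rw [div_mul_eq_mul_div, div_le_iff₀ (Real.exp_pos 1)]
    have := Real.exp_one_gt_d9
    linarith
  have key' := mul_le_mul_of_nonneg_left key (by positivity : 0 ≤ 3 / Real.exp 1)
  linarith

/-! ### Converse by change of measure -/

/-- Gibbs' inequality for $P$ against a tilted $R$. The event `C` has $R$-mass at most $\rho$, so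
dividing $R$ by $2\rho$ on it and by 2 elsewhere still leaves total mass at most 1. The tilt costs
$\log 2$ and gains $\log(1/\rho)$ on `C`. -/
theorem change_of_measure {Ω : Type} [Fintype Ω] (P R : Ω → ℝ) (hP : ∀ ω, 0 ≤ P ω)
    (hP1 : ∑ ω, P ω = 1) (hR : ∀ ω, 0 ≤ R ω) (hR1 : ∑ ω, R ω ≤ 1) (hac : ∀ ω, R ω = 0 → P ω = 0)
    (C : Ω → Prop) [DecidablePred C] {ρ : ℝ} (hρ : 0 < ρ)
    (hC : ∑ ω, (if C ω then R ω else 0) ≤ ρ) :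
    (∑ ω, if C ω then P ω else 0) * Real.log (1 / ρ)
      ≤ Real.log 2 + ∑ ω, P ω * Real.log (P ω / R ω) := by
  set R' : Ω → ℝ := fun ω => if C ω then R ω / (2 * ρ) else R ω / 2 with hR'
  have h1 : ∀ ω, P ω - R' ω ≤ P ω * Real.log (P ω / R ω)
      + (P ω * Real.log 2 - (if C ω then P ω else 0) * Real.log (1 / ρ)) := by
    intro ω
    have hR'0 : 0 ≤ R' ω := by
      have := hR ω
      simp only [hR']; split_ifs <;> positivity
    have hac' : R' ω = 0 → P ω = 0 := by
      intro h
      apply hac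
      simp only [hR'] at h
      split_ifs at h
      · rcases div_eq_zero_iff.1 h with h | h
        · exact h
        · linarith
      · linarith
    refine (sub_le_mul_log_div (hP ω) hR'0 hac').trans (le_of_eq ?_)
    rcases (hP ω).eq_or_lt with h | h
    · rw [← h]; simp
    have hRω : 0 < R ω := lt_of_le_of_ne (hR ω) fun h' => h.ne' (hac ω h'.symm)
    simp only [hR']
    split_ifs
    · rw [show P ω / (R ω / (2 * ρ)) = P ω / R ω * 2 * ρ by field_simp,
        Real.log_mul (by positivity) hρ.ne', Real.log_mul (by positivity) (by norm_num),
        one_div, Real.log_inv]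
      ring
    · rw [show P ω / (R ω / 2) = P ω / R ω * 2 by field_simp,
        Real.log_mul (by positivity) (by norm_num)]
      ring
  have h2 : ∑ ω, R' ω ≤ 1 := by
    have e : ∀ ω, R' ω = (if C ω then R ω else 0) * (1 / (2 * ρ))
        + (R ω - (if C ω then R ω else 0)) / 2 := by
      intro ω; simp only [hR']; split_ifs <;> ring
    have e2 : ∀ ω, R' ω ≤ (if C ω then R ω else 0) * (1 / (2 * ρ)) + R ω / 2 := by
      intro ω
      rw [e]
      have : 0 ≤ (if C ω then R ω else 0) := by
        have := hR ω
        split_ifs <;> positivity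
      linarith
    calc ∑ ω, R' ω ≤ ∑ ω, ((if C ω then R ω else 0) * (1 / (2 * ρ)) + R ω / 2) :=
          Finset.sum_le_sum fun ω _ => e2 ω
      _ = (∑ ω, if C ω then R ω else 0) * (1 / (2 * ρ)) + (∑ ω, R ω) / 2 := by
          rw [Finset.sum_add_distrib, Finset.sum_mul, Finset.sum_div]
      _ ≤ ρ * (1 / (2 * ρ)) + 1 / 2 := by gcongr
      _ = 1 := by field_simp; norm_num
  have h3 := Finset.sum_le_sum fun ω (_ : ω ∈ Finset.univ) => h1 ω
  rw [Finset.sum_add_distrib, Finset.sum_sub_distrib, Finset.sum_sub_distrib, ← Finset.sum_mul,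
    ← Finset.sum_mul, hP1] at h3
  linarith

theorem sum_prod_pi {n : ℕ} {Y : Type} [Fintype Y] (f : Fin n → Y → ℝ) :
    ∑ y : Fin n → Y, ∏ t, f t (y t) = ∏ t, ∑ a, f t a := by
  classical
  rw [Finset.prod_univ_sum, Fintype.piFinset_univ]

theorem sum_prod_pi₂ {n : ℕ} {Y Z : Type} [Fintype Y] [Fintype Z] (f : Fin n → Y → Z → ℝ) :
    ∑ y : Fin n → Y, ∑ z : Fin n → Z, ∏ t, f t (y t) (z t) = ∏ t, ∑ a, ∑ b, f t a b := by
  rw [← sum_prod_pi]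
  exact Finset.sum_congr rfl fun y _ => sum_prod_pi fun t b => f t (y t) b

theorem sum_prod_mul_coord {n : ℕ} {Y Z : Type} [Fintype Y] [Fintype Z] (V : Fin n → Y → Z → ℝ)
    (hV : ∀ t, ∑ a, ∑ b, V t a b = 1) (g : Y → Z → ℝ) (t₀ : Fin n) :
    ∑ y : Fin n → Y, ∑ z : Fin n → Z, (∏ t, V t (y t) (z t)) * g (y t₀) (z t₀)
      = ∑ a, ∑ b, V t₀ a b * g a b := by
  have e : ∀ (y : Fin n → Y) (z : Fin n → Z), (∏ t, V t (y t) (z t)) * g (y t₀) (z t₀)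
      = ∏ t, V t (y t) (z t) * (if t = t₀ then g (y t) (z t) else 1) := by
    intro y z
    rw [Finset.prod_mul_distrib, Finset.prod_ite_eq' Finset.univ t₀]
    simp
  simp only [e]
  rw [sum_prod_pi₂ fun t a b => V t a b * (if t = t₀ then g a b else 1)]
  rw [Finset.prod_eq_single t₀]
  · simp
  · intro t _ ht
    simp [ht, hV]
  · simp

section Converse

variable {X₁ X₂ Y₁ Y₂ : Type} [Fintype Y₁] [Fintype Y₂] {n M₁ M₂ : ℕ}

/-- Probability that both messages are decoded correctly with deterministic encoders. -/
def correctProb (W : X₁ → X₂ → Y₁ → Y₂ → ℝ) (f₁ : Fin M₁ → Fin n → X₁) (f₂ : Fin M₂ → Fin n → X₂)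
    (d₁ : (Fin n → Y₁) → Option (Fin M₁)) (d₂ : (Fin n → Y₂) → Option (Fin M₂)) : ℝ :=
  (∑ m₁, ∑ m₂, ∑ y₁ : Fin n → Y₁, ∑ y₂ : Fin n → Y₂,
    if d₁ y₁ = some m₁ ∧ d₂ y₂ = some m₂ then ∏ t, W (f₁ m₁ t) (f₂ m₂ t) (y₁ t) (y₂ t) else 0)
    / ((M₁ : ℝ) * M₂)

theorem sum_ite_some_le {α : Type} [Fintype α] [DecidableEq α] (o : Option α) {f : α → ℝ} {c : ℝ}
    (hc : 0 ≤ c) (hf : ∀ a, f a ≤ c) : ∑ a, (if o = some a then f a else 0) ≤ c := by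
  cases o with
  | none => simpa using hc
  | some b => simpa using hf b

/-- Genie-aided converse: receiver 2 knows the output and the message of receiver 1. -/
theorem genie_converse (W : X₁ → X₂ → Y₁ → Y₂ → ℝ) (hW : ∀ x₁ x₂ y₁ y₂, 0 ≤ W x₁ x₂ y₁ y₂)
    (hW1 : ∀ x₁ x₂, ∑ y₁, ∑ y₂, W x₁ x₂ y₁ y₂ = 1)
    (hM₁ : 0 < M₁) (hM₂ : 0 < M₂)
    (f₁ : Fin M₁ → Fin n → X₁) (f₂ : Fin M₂ → Fin n → X₂)
    (d₁ : (Fin n → Y₁) → Option (Fin M₁)) (d₂ : (Fin n → Y₂) → Option (Fin M₂))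
    (q : Fin n → Y₁ → ℝ) (s : Fin n → X₁ → Y₁ → Y₂ → ℝ)
    (hq : ∀ t a, 0 ≤ q t a) (hq1 : ∀ t, ∑ a, q t a ≤ 1)
    (hs : ∀ t x a b, 0 ≤ s t x a b) (hs1 : ∀ t x a, ∑ b, s t x a b ≤ 1)
    (hac : ∀ t m₁ m₂ a b, q t a * s t (f₁ m₁ t) a b = 0 → W (f₁ m₁ t) (f₂ m₂ t) a b = 0) :
    correctProb W f₁ f₂ d₁ d₂ * Real.log ((M₁ : ℝ) * M₂) ≤ Real.log 2 +
      ∑ t, (∑ m₁, ∑ m₂, ∑ a, ∑ b, W (f₁ m₁ t) (f₂ m₂ t) a b *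
        Real.log (W (f₁ m₁ t) (f₂ m₂ t) a b / (q t a * s t (f₁ m₁ t) a b))) / ((M₁ : ℝ) * M₂) := by
  have hM : 0 < (M₁ : ℝ) * M₂ := by positivity
  set M : ℝ := (M₁ : ℝ) * M₂ with hMdef
  let P : Fin M₁ × Fin M₂ × (Fin n → Y₁) × (Fin n → Y₂) → ℝ := fun ω =>
    (∏ t, W (f₁ ω.1 t) (f₂ ω.2.1 t) (ω.2.2.1 t) (ω.2.2.2 t)) / M
  -- Under `R` the output $y_1$ is independent of both messages, and $y_2$ depends on $m_1,y_1$ but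
  -- not on $m_2$. Both decoders succeed with probability at most $1/M$, whatever they are.
  let R : Fin M₁ × Fin M₂ × (Fin n → Y₁) × (Fin n → Y₂) → ℝ := fun ω =>
    (∏ t, q t (ω.2.2.1 t) * s t (f₁ ω.1 t) (ω.2.2.1 t) (ω.2.2.2 t)) / M
  have hqs : ∀ m₁, ∑ y₁ : Fin n → Y₁, ∑ y₂ : Fin n → Y₂,
      ∏ t, q t (y₁ t) * s t (f₁ m₁ t) (y₁ t) (y₂ t) ≤ 1 := by
    intro m₁
    rw [sum_prod_pi₂ fun t a b => q t a * s t (f₁ m₁ t) a b]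
    apply Finset.prod_le_one
    · intro t _
      exact Finset.sum_nonneg fun a _ => Finset.sum_nonneg fun b _ => mul_nonneg (hq t a) (hs _ _ _ _)
    · intro t _
      refine le_trans (Finset.sum_le_sum fun a _ => ?_) (hq1 t)
      rw [← Finset.mul_sum]
      exact mul_le_of_le_one_right (hq t a) (hs1 _ _ _)
  have hWp : ∀ m₁ m₂, ∑ y₁ : Fin n → Y₁, ∑ y₂ : Fin n → Y₂,
      ∏ t, W (f₁ m₁ t) (f₂ m₂ t) (y₁ t) (y₂ t) = 1 := by
    intro m₁ m₂
    rw [sum_prod_pi₂ fun t a b => W (f₁ m₁ t) (f₂ m₂ t) a b]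
    simp [hW1]
  have key := change_of_measure P R
    (fun ω => div_nonneg (Finset.prod_nonneg fun t _ => hW _ _ _ _) hM.le)
    (by
      simp only [P, Fintype.sum_prod_type, ← Finset.sum_div]
      simp only [hWp]
      simp [hMdef, hM₁.ne', hM₂.ne'])
    (fun ω => div_nonneg (Finset.prod_nonneg fun t _ => mul_nonneg (hq _ _) (hs _ _ _ _)) hM.le)
    (by
      simp only [R, Fintype.sum_prod_type, ← Finset.sum_div]
      rw [div_le_one hM]
      refine (Finset.sum_le_sum fun m₁ _ => Finset.sum_le_sum fun m₂ _ => hqs m₁).trans ?_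
      simp [hMdef])
    (by
      intro ω h
      simp only [P, R] at h ⊢
      rw [div_eq_zero_iff, or_iff_left hM.ne', Finset.prod_eq_zero_iff] at h ⊢
      obtain ⟨t, ht, h⟩ := h
      exact ⟨t, ht, hac _ _ _ _ _ h⟩)
    (fun ω => d₁ ω.2.2.1 = some ω.1 ∧ d₂ ω.2.2.2 = some ω.2.1) (ρ := 1 / M) (by positivity)
    (by
      simp only [R, Fintype.sum_prod_type]
      have e : ∀ (m₁ : Fin M₁) (m₂ : Fin M₂) (y₁ : Fin n → Y₁) (y₂ : Fin n → Y₂),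
          (if d₁ y₁ = some m₁ ∧ d₂ y₂ = some m₂ then
            (∏ t, q t (y₁ t) * s t (f₁ m₁ t) (y₁ t) (y₂ t)) / M else 0)
          = (if d₁ y₁ = some m₁ then (∏ t, q t (y₁ t)) *
            (if d₂ y₂ = some m₂ then ∏ t, s t (f₁ m₁ t) (y₁ t) (y₂ t) else 0) else 0) / M := by
        intro m₁ m₂ y₁ y₂
        rw [Finset.prod_mul_distrib]
        split_ifs <;> simp_all
      simp only [e, ← Finset.sum_div]
      apply div_le_div_of_nonneg_right _ hM.le
      have sw : ∑ m₁, ∑ m₂, ∑ y₁ : Fin n → Y₁, ∑ y₂ : Fin n → Y₂,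
          (if d₁ y₁ = some m₁ then (∏ t, q t (y₁ t)) *
            (if d₂ y₂ = some m₂ then ∏ t, s t (f₁ m₁ t) (y₁ t) (y₂ t) else 0) else 0)
          = ∑ y₁ : Fin n → Y₁, ∑ m₁, if d₁ y₁ = some m₁ then (∏ t, q t (y₁ t)) *
            ∑ y₂ : Fin n → Y₂, ∑ m₂,
              (if d₂ y₂ = some m₂ then ∏ t, s t (f₁ m₁ t) (y₁ t) (y₂ t) else 0) else 0 := by
        rw [Finset.sum_comm' (t' := Finset.univ) (s' := fun _ => Finset.univ) (by simp)]
        rw [Finset.sum_comm]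
        simp only [Finset.sum_comm (s := (Finset.univ : Finset (Fin M₂)))
          (t := (Finset.univ : Finset (Fin n → Y₁)))]
        rw [Finset.sum_comm]
        refine Finset.sum_congr rfl fun y₁ _ => Finset.sum_congr rfl fun m₁ _ => ?_
        split_ifs
        · rw [Finset.sum_comm]
          simp only [Finset.mul_sum]
        · simp
      rw [sw]
      have hq0 : ∀ y₁ : Fin n → Y₁, 0 ≤ ∏ t, q t (y₁ t) :=
        fun y₁ => Finset.prod_nonneg fun t _ => hq _ _
      calc _ ≤ ∑ y₁ : Fin n → Y₁, ∏ t, q t (y₁ t) := by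
            refine Finset.sum_le_sum fun y₁ _ => sum_ite_some_le _ (hq0 y₁) fun m₁ => ?_
            apply mul_le_of_le_one_right (hq0 y₁)
            calc _ ≤ ∑ y₂ : Fin n → Y₂, ∏ t, s t (f₁ m₁ t) (y₁ t) (y₂ t) :=
                  Finset.sum_le_sum fun y₂ _ => sum_ite_some_le _
                    (Finset.prod_nonneg fun t _ => hs _ _ _ _) fun m₂ => le_rfl
              _ = ∏ t, ∑ b, s t (f₁ m₁ t) (y₁ t) b := sum_prod_pi fun t b => s t (f₁ m₁ t) (y₁ t) b
              _ ≤ 1 := Finset.prod_le_one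
                  (fun t _ => Finset.sum_nonneg fun b _ => hs _ _ _ _) fun t _ => hs1 _ _ _
        _ = ∏ t, ∑ a, q t a := sum_prod_pi q
        _ ≤ 1 := Finset.prod_le_one
            (fun t _ => Finset.sum_nonneg fun b _ => hq _ _) fun t _ => hq1 _)
  have hlog : ∀ ω, P ω * Real.log (P ω / R ω) = ∑ t, ((∏ t, W (f₁ ω.1 t) (f₂ ω.2.1 t) (ω.2.2.1 t) (ω.2.2.2 t)) *
      Real.log (W (f₁ ω.1 t) (f₂ ω.2.1 t) (ω.2.2.1 t) (ω.2.2.2 t) /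
        (q t (ω.2.2.1 t) * s t (f₁ ω.1 t) (ω.2.2.1 t) (ω.2.2.2 t)))) / M := by
    intro ω
    -- Where $P$ vanishes both sides are 0; elsewhere `hac` makes every factor of $R$ nonzero, so
    -- the logarithm of the product splits.
    by_cases h : ∏ t, W (f₁ ω.1 t) (f₂ ω.2.1 t) (ω.2.2.1 t) (ω.2.2.2 t) = 0
    · simp [P, h]
    · have h' := Finset.prod_ne_zero_iff.1 h
      have e : P ω / R ω = ∏ t, (W (f₁ ω.1 t) (f₂ ω.2.1 t) (ω.2.2.1 t) (ω.2.2.2 t) /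
        (q t (ω.2.2.1 t) * s t (f₁ ω.1 t) (ω.2.2.1 t) (ω.2.2.2 t))) := by
        simp only [P, R]
        rw [div_div_div_cancel_right₀ hM.ne', Finset.prod_div_distrib]
      rw [e, Real.log_prod (fun t ht => div_ne_zero (h' t ht) fun h0 => h' t ht (hac _ _ _ _ _ h0)),
        Finset.mul_sum]
      refine Finset.sum_congr rfl fun t _ => ?_
      simp only [P]; ring
  have hsum : ∑ ω, P ω * Real.log (P ω / R ω) =
      ∑ t, (∑ m₁, ∑ m₂, ∑ a, ∑ b, W (f₁ m₁ t) (f₂ m₂ t) a b *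
        Real.log (W (f₁ m₁ t) (f₂ m₂ t) a b / (q t a * s t (f₁ m₁ t) a b))) / M := by
    simp only [hlog]
    rw [Finset.sum_comm]
    refine Finset.sum_congr rfl fun t _ => ?_
    simp only [Fintype.sum_prod_type, ← Finset.sum_div]
    congr 1
    refine Finset.sum_congr rfl fun m₁ _ => Finset.sum_congr rfl fun m₂ _ => ?_
    exact sum_prod_mul_coord (fun t a b => W (f₁ m₁ t) (f₂ m₂ t) a b) (fun t => hW1 _ _)
      (fun a b => Real.log (W (f₁ m₁ t) (f₂ m₂ t) a b / (q t a * s t (f₁ m₁ t) a b))) t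
  have hcorr : (∑ ω : Fin M₁ × Fin M₂ × (Fin n → Y₁) × (Fin n → Y₂),
      if d₁ ω.2.2.1 = some ω.1 ∧ d₂ ω.2.2.2 = some ω.2.1 then P ω else 0)
      = correctProb W f₁ f₂ d₁ d₂ := by
    simp only [correctProb, Fintype.sum_prod_type, P, Finset.sum_div]
    refine Finset.sum_congr rfl fun _ _ => Finset.sum_congr rfl fun _ _ =>
      Finset.sum_congr rfl fun _ _ => Finset.sum_congr rfl fun _ _ => ?_
    split_ifs <;> simp [hMdef]
  rw [hcorr, hsum, one_div_one_div] at key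
  exact key

end Converse

/-! ### Single-letter quantities for Channel II -/

/-- The input of the other sender that carries the bit `b` and wins against `x`. -/
def partner (x : Bool × Bool) (b : Bool) : Bool × Bool := (b, xor x.2 (x.1 && b))

/-- Probability that `x` wins against an input with law `r`. -/
def adj (r : Bool × Bool → ℝ) (x : Bool × Bool) : ℝ := r (partner x false) + r (partner x true)

/-- Probability of winning with the bit `b` sent by the first sender. -/
def outMass (p r : Bool × Bool → ℝ) (b : Bool) : ℝ :=
  p (b, false) * adj r (b, false) + p (b, true) * adj r (b, true)

def winProb (p r : Bool × Bool → ℝ) : ℝ := outMass p r false + outMass p r true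

/-- Law of the output of the first receiver. -/
def auxOut (ε : ℝ) (p r : Bool × Bool → ℝ) : Option Bool → ℝ
  | none => 1 - ε * winProb p r
  | some b => ε * outMass p r b

/-- Law of the output of the second receiver, given input and output of the first pair. -/
def auxCond (r : Bool × Bool → ℝ) (x : Bool × Bool) : Option Bool → Option Bool → ℝ
  | none, none => 1
  | some _, some b => r (partner x b) / adj r x
  | _, _ => 0

def logLik (ε : ℝ) (p r : Bool × Bool → ℝ) (x₁ x₂ : Bool × Bool) : ℝ :=
  ∑ a, ∑ b, channelIIProb ε x₁ x₂ a b *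
    Real.log (channelIIProb ε x₁ x₂ a b / (auxOut ε p r a * auxCond r x₁ a b))

theorem channelIIProb_eq (ε : ℝ) (x₁ x₂ : Bool × Bool) (y₁ y₂ : Option Bool) :
    channelIIProb ε x₁ x₂ y₁ y₂ =
      if x₂ = partner x₁ x₂.1 then
        (if y₁ = some x₁.1 ∧ y₂ = some x₂.1 then ε else if y₁ = none ∧ y₂ = none then 1 - ε else 0)
      else if y₁ = none ∧ y₂ = none then 1 else 0 := by
  obtain ⟨_ | _, _ | _⟩ := x₁ <;> obtain ⟨_ | _, _ | _⟩ := x₂ <;>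
    simp [channelIIProb, channelIITable, partner]

theorem channelIIProb_swap (ε : ℝ) (x₁ x₂ : Bool × Bool) (y₁ y₂ : Option Bool) :
    channelIIProb ε x₁ x₂ y₁ y₂ = channelIIProb ε x₂ x₁ y₂ y₁ := by
  obtain ⟨_ | _, _ | _⟩ := x₁ <;> obtain ⟨_ | _, _ | _⟩ := x₂ <;>
    simp [channelIIProb, channelIITable, and_comm]

theorem div_mul_mul_div_cancel {ε : ℝ} (hε : ε ≠ 0) (Q r A : ℝ) :
    ε / (ε * Q * (r / A)) = A / (Q * r) := by
  rw [mul_assoc, ← div_div, div_self hε, one_div]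
  simp only [div_eq_mul_inv, mul_inv, inv_inv]
  ring

theorem sum_erasure_mul_log (ε : ℝ) (u v : Bool) (g : Option Bool → Option Bool → ℝ) :
    ∑ a, ∑ b, (if a = some u ∧ b = some v then ε else if a = none ∧ b = none then 1 - ε else 0) *
      Real.log ((if a = some u ∧ b = some v then ε else if a = none ∧ b = none then 1 - ε else 0)
        / g a b)
      = ε * Real.log (ε / g (some u) (some v)) + (1 - ε) * Real.log ((1 - ε) / g none none) := by
  cases u <;> cases v <;> simp [Fintype.sum_option] <;> ring

/-- On a win the factor $\varepsilon$ cancels inside the logarithm, so the part without erasure is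
exactly linear in $\varepsilon$. -/
theorem logLik_eq {ε : ℝ} (hε : ε ≠ 0) (p r : Bool × Bool → ℝ) (x₁ x₂ : Bool × Bool) :
    logLik ε p r x₁ x₂ =
      if x₂ = partner x₁ x₂.1 then
        ε * Real.log (adj r x₁ / (outMass p r x₁.1 * r x₂))
          + (1 - ε) * Real.log ((1 - ε) / (1 - ε * winProb p r))
      else Real.log (1 / (1 - ε * winProb p r)) := by
  unfold logLik
  simp only [channelIIProb_eq]
  split_ifs with h
  · rw [sum_erasure_mul_log ε x₁.1 x₂.1 fun a b => auxOut ε p r a * auxCond r x₁ a b]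
    simp only [auxOut, auxCond, mul_one]
    rw [div_mul_mul_div_cancel hε, ← h]
  · simp [Fintype.sum_option, auxOut, auxCond]

theorem outMass_nonneg {p r : Bool × Bool → ℝ} (hp : ∀ x, 0 ≤ p x) (hr : ∀ x, 0 ≤ r x) (b : Bool) :
    0 ≤ outMass p r b := by
  have := hp (b, false); have := hp (b, true)
  unfold outMass adj
  exact add_nonneg (mul_nonneg (hp _) (add_nonneg (hr _) (hr _)))
    (mul_nonneg (hp _) (add_nonneg (hr _) (hr _)))

theorem winProb_comm (p r : Bool × Bool → ℝ) : winProb p r = winProb r p := by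
  simp [winProb, outMass, adj, partner]; ring

theorem sum_bool_prod (p : Bool × Bool → ℝ) :
    ∑ x, p x = p (false, false) + p (true, false) + p (false, true) + p (true, true) := by
  simp [Fintype.sum_prod_type]; ring

theorem winProb_le_one {p r : Bool × Bool → ℝ} (hp : ∀ x, 0 ≤ p x) (hr : ∀ x, 0 ≤ r x)
    (hp1 : ∑ x, p x = 1) (hr1 : ∑ x, r x = 1) : winProb p r ≤ 1 := by
  rw [sum_bool_prod] at hp1 hr1
  have e : winProb p r ≤ (p (false, false) + p (true, false) + p (false, true) + p (true, true)) *
      (r (false, false) + r (true, false) + r (false, true) + r (true, true)) := by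
    simp only [winProb, outMass, adj, partner, Bool.xor_false, Bool.and_false, Bool.xor_true,
      Bool.not_false, Bool.not_true, Bool.and_true]
    have h := fun x y => mul_nonneg (hp x) (hr y)
    have h1 := h (false, false) (false, true)
    have h2 := h (false, false) (true, true)
    have h3 := h (true, false) (true, false)
    have h4 := h (true, false) (false, true)
    have h5 := h (false, true) (false, false)
    have h6 := h (false, true) (true, false)
    have h7 := h (true, true) (false, false)
    have h8 := h (true, true) (true, true)
    nlinarith
  rwa [hp1, hr1, one_mul] at e

/-- With $\log u\le u-1$ the first-order terms $-\varepsilon w(1-w)$ and $+\varepsilon w(1-w)$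
cancel, and $w(1-w)\varepsilon^2/(1-\varepsilon w)$ remains. -/
theorem erasure_term {ε w : ℝ} (h0 : 0 < ε) (h1 : ε ≤ 1 / 2) (hw0 : 0 ≤ w) (hw1 : w ≤ 1) :
    w * ((1 - ε) * Real.log ((1 - ε) / (1 - ε * w))) + (1 - w) * Real.log (1 / (1 - ε * w))
      ≤ 2 * ε ^ 2 := by
  have hew : ε * w ≤ 1 / 2 := by nlinarith
  have hd : 0 < 1 - ε * w := by linarith
  have l1 := Real.log_le_sub_one_of_pos (show 0 < (1 - ε) / (1 - ε * w) from div_pos (by linarith) hd)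
  have l2 := Real.log_le_sub_one_of_pos (show 0 < 1 / (1 - ε * w) from div_pos one_pos hd)
  have m1 := mul_le_mul_of_nonneg_left l1 (mul_nonneg hw0 (by linarith : 0 ≤ 1 - ε))
  have m2 := mul_le_mul_of_nonneg_left l2 (by linarith : 0 ≤ 1 - w)
  have e : w * (1 - ε) * ((1 - ε) / (1 - ε * w) - 1) + (1 - w) * (1 / (1 - ε * w) - 1)
      = w * (1 - w) * ε ^ 2 / (1 - ε * w) := by
    have hd' := hd.ne'
    rw [div_sub_one hd', div_sub_one hd', mul_div_assoc', mul_div_assoc', ← add_div]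
    congr 1
    ring
  have e2 : w * (1 - w) * ε ^ 2 / (1 - ε * w) ≤ 2 * ε ^ 2 := by
    rw [div_le_iff₀ hd]
    nlinarith [mul_nonneg (mul_nonneg hw0 hw0) (sq_nonneg ε), sq_nonneg ε,
      mul_nonneg (sq_nonneg ε) (by linarith : 0 ≤ 1 / 2 - ε * w), mul_nonneg (sq_nonneg ε) (sub_nonneg.2 hw1)]
  linarith

/-- The two genie bounds, averaged over independent inputs. -/
theorem logLik_sum_le {ε : ℝ} (h0 : 0 < ε) (h1 : ε ≤ 1 / 2) {p r : Bool × Bool → ℝ}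
    (hp : ∀ x, 0 ≤ p x) (hr : ∀ x, 0 ≤ r x) (hp1 : ∑ x, p x = 1) (hr1 : ∑ x, r x = 1) :
    ∑ x₁, ∑ x₂, p x₁ * r x₂ * (logLik ε p r x₁ x₂ + logLik ε r p x₂ x₁)
      ≤ 2 * (1.183 * ε + 2 * ε ^ 2) := by
  have hw1 := winProb_le_one hp hr hp1 hr1
  have hw0 : 0 ≤ winProb p r := add_nonneg (outMass_nonneg hp hr _) (outMass_nonneg hp hr _)
  have er := erasure_term h0 h1 hw0 hw1
  rw [sum_bool_prod] at hp1 hr1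
  -- Order around the cycle, as bits $ma$:
  -- $p_{00},r_{00},p_{10},r_{11},p_{01},r_{01},p_{11},r_{10}$. Neighbours win against each other;
  -- antipodes share the bit $m$.
  have key := eight_cycle_bound (hp (false, false)) (hr (false, false)) (hp (true, false))
    (hr (true, true)) (hp (false, true)) (hr (false, true)) (hp (true, true)) (hr (true, false))
    (by linarith) (by linarith)
    (A₀ := adj r (false, false)) (A₁ := adj p (false, false)) (A₂ := adj r (true, false))
    (A₃ := adj p (true, true)) (A₄ := adj r (false, true)) (A₅ := adj p (false, true))
    (A₆ := adj r (true, true)) (A₇ := adj p (true, false))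
    (Q₀ := outMass p r false) (Q₁ := outMass r p false) (Q₂ := outMass p r true)
    (Q₃ := outMass r p true)
    (by simp [adj, partner, add_comm]) (by simp [adj, partner])
    (by simp [adj, partner]) (by simp [adj, partner, add_comm])
    (by simp [adj, partner, add_comm]) (by simp [adj, partner])
    (by simp [adj, partner]) (by simp [adj, partner, add_comm])
    rfl rfl (by simp [outMass]) (by simp [outMass, add_comm])
  have hwe : winProb p r = p (false, false) * (r (false, false) + r (true, false))
      + p (false, true) * (r (false, true) + r (true, true))
      + (p (true, false) * (r (false, false) + r (true, true))
      + p (true, true) * (r (false, true) + r (true, false))) := by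
    simp [winProb, outMass, adj, partner]
  have hc := winProb_comm r p
  simp only [logLik_eq h0.ne', hc]
  generalize Real.log ((1 - ε) / (1 - ε * winProb p r)) = L₁ at *
  generalize Real.log (1 / (1 - ε * winProb p r)) = L₂ at *
  simp only [Fintype.sum_prod_type, Fintype.sum_bool]
  simp only [partner, Prod.mk.injEq, Bool.xor_false, Bool.and_false, Bool.xor_true,
    Bool.not_false, Bool.not_true, Bool.and_true, true_and, if_true, if_false, reduceCtorEq]
  have key' := mul_le_mul_of_nonneg_left key h0.le
  have one : (p (false, false) + p (true, false) + p (false, true) + p (true, true)) *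
      (r (false, false) + r (true, false) + r (false, true) + r (true, true)) = 1 := by
    rw [hp1, hr1, one_mul]
  have one' : ((p (false, false) + p (true, false) + p (false, true) + p (true, true)) *
      (r (false, false) + r (true, false) + r (false, true) + r (true, true))) * L₂ = L₂ := by
    rw [one, one_mul]
  rw [hwe] at er
  linarith

/-! ### From codes to input laws -/

/-- Law of the input that a uniformly chosen message is encoded into. -/
def inputLaw {X : Type} [DecidableEq X] {M : ℕ} (f : Fin M → X) (x : X) : ℝ :=
  (∑ m, if f m = x then 1 else 0) / M

section InputLaw

variable {X : Type} [DecidableEq X] {M : ℕ} (f : Fin M → X)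

theorem inputLaw_nonneg (x : X) : 0 ≤ inputLaw f x :=
  div_nonneg (Finset.sum_nonneg fun _ _ => by split_ifs <;> norm_num) (Nat.cast_nonneg _)

theorem sum_inputLaw_mul [Fintype X] (g : X → ℝ) :
    ∑ x, inputLaw f x * g x = (∑ m, g (f m)) / M := by
  simp only [inputLaw, div_mul_eq_mul_div, Finset.sum_mul, ← Finset.sum_div]
  rw [Finset.sum_comm]
  simp

theorem sum_inputLaw [Fintype X] (hM : 0 < M) : ∑ x, inputLaw f x = 1 := by
  have h := sum_inputLaw_mul f fun _ => 1
  simpa [hM.ne'] using h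

theorem inputLaw_pos (m : Fin M) : 0 < inputLaw f (f m) := by
  have hM : 0 < M := m.pos
  refine div_pos (Finset.sum_pos' (fun _ _ => by split_ifs <;> norm_num) ⟨m, by simp⟩) (by positivity)

end InputLaw

theorem sum_inputLaw_mul₂ {X₁ X₂ : Type} [DecidableEq X₁] [DecidableEq X₂] [Fintype X₁] [Fintype X₂]
    {M₁ M₂ : ℕ} (f₁ : Fin M₁ → X₁) (f₂ : Fin M₂ → X₂) (g : X₁ → X₂ → ℝ) :
    ∑ x₁, ∑ x₂, inputLaw f₁ x₁ * inputLaw f₂ x₂ * g x₁ x₂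
      = (∑ m₁, ∑ m₂, g (f₁ m₁) (f₂ m₂)) / ((M₁ : ℝ) * M₂) := by
  simp only [mul_assoc, ← Finset.mul_sum, sum_inputLaw_mul, ← Finset.sum_div]
  rw [div_div, mul_comm (M₂ : ℝ)]

theorem adj_nonneg {r : Bool × Bool → ℝ} (hr : ∀ x, 0 ≤ r x) (x : Bool × Bool) : 0 ≤ adj r x :=
  add_nonneg (hr _) (hr _)

theorem le_adj {r : Bool × Bool → ℝ} (hr : ∀ x, 0 ≤ r x) (x : Bool × Bool) (b : Bool) :
    r (partner x b) ≤ adj r x := by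
  cases b
  · exact le_add_of_nonneg_right (hr _)
  · exact le_add_of_nonneg_left (hr _)

theorem mul_adj_le_outMass {p r : Bool × Bool → ℝ} (hp : ∀ x, 0 ≤ p x) (hr : ∀ x, 0 ≤ r x)
    (x : Bool × Bool) : p x * adj r x ≤ outMass p r x.1 := by
  have h := fun y => mul_nonneg (hp y) (adj_nonneg hr y)
  obtain ⟨b, _ | _⟩ := x
  · exact le_add_of_nonneg_right (h _)
  · exact le_add_of_nonneg_left (h _)

theorem auxOut_nonneg {ε : ℝ} (h0 : 0 < ε) (h1 : ε ≤ 1 / 2) {p r : Bool × Bool → ℝ}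
    (hp : ∀ x, 0 ≤ p x) (hr : ∀ x, 0 ≤ r x) (hp1 : ∑ x, p x = 1) (hr1 : ∑ x, r x = 1)
    (a : Option Bool) : 0 ≤ auxOut ε p r a := by
  cases a with
  | none =>
    have := winProb_le_one hp hr hp1 hr1
    simp only [auxOut]
    nlinarith
  | some b => exact mul_nonneg h0.le (outMass_nonneg hp hr b)

theorem sum_auxOut (ε : ℝ) (p r : Bool × Bool → ℝ) : ∑ a, auxOut ε p r a = 1 := by
  simp [Fintype.sum_option, auxOut, winProb]; ring

theorem auxCond_nonneg {r : Bool × Bool → ℝ} (hr : ∀ x, 0 ≤ r x) (x : Bool × Bool)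
    (a b : Option Bool) : 0 ≤ auxCond r x a b := by
  cases a <;> cases b <;> simp [auxCond]
  exact div_nonneg (hr _) (adj_nonneg hr _)

/-- Equality can fail: if `adj r x` is 0, the quotients are 0 by convention. A sub-probability
suffices for the converse. -/
theorem sum_auxCond_le (r : Bool × Bool → ℝ) (x : Bool × Bool) (a : Option Bool) :
    ∑ b, auxCond r x a b ≤ 1 := by
  cases a with
  | none => simp [Fintype.sum_option, auxCond]
  | some a =>
    simp only [Fintype.sum_option, auxCond, Fintype.sum_bool, zero_add, ← add_div]
    rw [add_comm]
    exact div_self_le_one _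

/-- Absolute continuity for the change of measure. Letters in actual use have positive mass, so each
output they can produce has positive auxiliary probability. -/
theorem channelIIProb_eq_zero_of_aux {ε : ℝ} (h0 : 0 < ε) (h1 : ε ≤ 1 / 2)
    {p r : Bool × Bool → ℝ} (hp : ∀ x, 0 ≤ p x) (hr : ∀ x, 0 ≤ r x) (hp1 : ∑ x, p x = 1)
    (hr1 : ∑ x, r x = 1) {x₁ x₂ : Bool × Bool} (h₁ : 0 < p x₁) (h₂ : 0 < r x₂) {a b : Option Bool}
    (h : auxOut ε p r a * auxCond r x₁ a b = 0) : channelIIProb ε x₁ x₂ a b = 0 := by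
  rw [channelIIProb_eq]
  cases a with
  | none =>
    cases b with
    | none =>
      have := winProb_le_one hp hr hp1 hr1
      simp only [auxOut, auxCond, mul_one] at h
      nlinarith
    | some b => simp
  | some a =>
    cases b with
    | none => simp
    | some b =>
      by_cases hx : x₂ = partner x₁ x₂.1
      · by_cases hab : a = x₁.1 ∧ b = x₂.1
        · exfalso
          obtain ⟨rfl, rfl⟩ := hab
          have hA : 0 < adj r x₁ := by
            have := le_adj hr x₁ x₂.1
            rw [← hx] at this
            linarith
          have hQ := (mul_pos h₁ hA).trans_le (mul_adj_le_outMass hp hr x₁)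
          simp only [auxOut, auxCond, ← hx] at h
          exact (mul_pos (mul_pos h0 hQ) (div_pos h₂ hA)).ne' h
        · simp [hab]
      · simp [hx]

theorem correctProb_swap {n M₁ M₂ : ℕ} {X₁ X₂ Y₁ Y₂ : Type} [Fintype Y₁] [Fintype Y₂]
    (W : X₁ → X₂ → Y₁ → Y₂ → ℝ) (f₁ : Fin M₁ → Fin n → X₁) (f₂ : Fin M₂ → Fin n → X₂)
    (d₁ : (Fin n → Y₁) → Option (Fin M₁)) (d₂ : (Fin n → Y₂) → Option (Fin M₂)) :
    correctProb (fun x₂ x₁ y₂ y₁ => W x₁ x₂ y₁ y₂) f₂ f₁ d₂ d₁ = correctProb W f₁ f₂ d₁ d₂ := by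
  unfold correctProb
  rw [Finset.sum_comm, mul_comm (M₂ : ℝ)]
  congr 1
  refine Finset.sum_congr rfl fun _ _ => Finset.sum_congr rfl fun _ _ => ?_
  rw [Finset.sum_comm]
  refine Finset.sum_congr rfl fun _ _ => Finset.sum_congr rfl fun _ _ => ?_
  simp only [and_comm]

/-- With fixed encoders and independent uniform messages the two letters at time $t$ are
independent. The genie bound and its mirror image are averaged, and `logLik_sum_le` applies at each
$t$. -/
theorem correctProb_mul_log_le {ε : ℝ} (hε : ε ∈ Set.Icc (0 : ℝ) 1) (h0 : 0 < ε) (h1 : ε ≤ 1 / 2)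
    {n M₁ M₂ : ℕ} (hM₁ : 0 < M₁) (hM₂ : 0 < M₂)
    (f₁ : Fin M₁ → Fin n → Bool × Bool) (f₂ : Fin M₂ → Fin n → Bool × Bool)
    (d₁ : (Fin n → Option Bool) → Option (Fin M₁)) (d₂ : (Fin n → Option Bool) → Option (Fin M₂)) :
    correctProb (channelIIProb ε) f₁ f₂ d₁ d₂ * Real.log ((M₁ : ℝ) * M₂)
      ≤ Real.log 2 + n * (1.183 * ε + 2 * ε ^ 2) := by
  let p : Fin n → Bool × Bool → ℝ := fun t => inputLaw fun m => f₁ m t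
  let r : Fin n → Bool × Bool → ℝ := fun t => inputLaw fun m => f₂ m t
  have hp : ∀ t x, 0 ≤ p t x := fun t => inputLaw_nonneg _
  have hr : ∀ t x, 0 ≤ r t x := fun t => inputLaw_nonneg _
  have hp1 : ∀ t, ∑ x, p t x = 1 := fun t => sum_inputLaw _ hM₁
  have hr1 : ∀ t, ∑ x, r t x = 1 := fun t => sum_inputLaw _ hM₂
  have hpp : ∀ t m, 0 < p t (f₁ m t) := fun t => inputLaw_pos fun m => f₁ m t
  have hrp : ∀ t m, 0 < r t (f₂ m t) := fun t => inputLaw_pos fun m => f₂ m t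
  have g₁ := genie_converse (channelIIProb ε) (channelII ε hε).nonneg (channelII ε hε).sum_one
    hM₁ hM₂ f₁ f₂ d₁ d₂ (fun t => auxOut ε (p t) (r t)) (fun t => auxCond (r t))
    (fun t => auxOut_nonneg h0 h1 (hp t) (hr t) (hp1 t) (hr1 t)) (fun t => (sum_auxOut _ _ _).le)
    (fun t => auxCond_nonneg (hr t)) (fun t => sum_auxCond_le (r t))
    (fun t m₁ m₂ a b => channelIIProb_eq_zero_of_aux h0 h1 (hp t) (hr t) (hp1 t) (hr1 t)
      (hpp t m₁) (hrp t m₂))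
  have g₂ := genie_converse (channelIIProb ε) (channelII ε hε).nonneg (channelII ε hε).sum_one
    hM₂ hM₁ f₂ f₁ d₂ d₁ (fun t => auxOut ε (r t) (p t)) (fun t => auxCond (p t))
    (fun t => auxOut_nonneg h0 h1 (hr t) (hp t) (hr1 t) (hp1 t)) (fun t => (sum_auxOut _ _ _).le)
    (fun t => auxCond_nonneg (hp t)) (fun t => sum_auxCond_le (p t))
    (fun t m₁ m₂ a b => channelIIProb_eq_zero_of_aux h0 h1 (hr t) (hp t) (hr1 t) (hp1 t)
      (hrp t m₁) (hpp t m₂))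
  have sw : correctProb (channelIIProb ε) f₂ f₁ d₂ d₁ = correctProb (channelIIProb ε) f₁ f₂ d₁ d₂ := by
    rw [← correctProb_swap (channelIIProb ε) f₁ f₂ d₁ d₂]
    congr 1
    funext x₂ x₁ y₂ y₁
    exact channelIIProb_swap _ _ _ _ _
  rw [sw, mul_comm (M₂ : ℝ)] at g₂
  have e₁ : ∀ t, (∑ m₁, ∑ m₂, logLik ε (p t) (r t) (f₁ m₁ t) (f₂ m₂ t)) / ((M₁ : ℝ) * M₂)
      + (∑ m₂, ∑ m₁, logLik ε (r t) (p t) (f₂ m₂ t) (f₁ m₁ t)) / ((M₁ : ℝ) * M₂)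
      ≤ 2 * (1.183 * ε + 2 * ε ^ 2) := by
    intro t
    rw [Finset.sum_comm (f := fun m₂ m₁ => logLik ε (r t) (p t) (f₂ m₂ t) (f₁ m₁ t)), ← add_div]
    simp only [← Finset.sum_add_distrib]
    rw [← sum_inputLaw_mul₂ (fun m => f₁ m t) (fun m => f₂ m t)
      (fun x₁ x₂ => logLik ε (p t) (r t) x₁ x₂ + logLik ε (r t) (p t) x₂ x₁)]
    exact logLik_sum_le h0 h1 (hp t) (hr t) (hp1 t) (hr1 t)
  have e₂ := Finset.sum_le_sum fun t (_ : t ∈ Finset.univ) => e₁ t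
  rw [Finset.sum_add_distrib, Finset.sum_const, Finset.card_univ, Fintype.card_fin, nsmul_eq_mul]
    at e₂
  simp only [logLik] at e₂
  linarith

/-! ### Shared randomness and the classical sum-capacity -/

theorem sum_ite_pair_mul {ι X₁ X₂ : Type} [Fintype ι] [Fintype X₁] [Fintype X₂] [DecidableEq X₁]
    [DecidableEq X₂] (w : ι → ℝ) (a : ι → X₁) (b : ι → X₂) (G : X₁ → X₂ → ℝ) :
    ∑ x₁, ∑ x₂, (∑ i, if a i = x₁ ∧ b i = x₂ then w i else 0) * G x₁ x₂
      = ∑ i, w i * G (a i) (b i) := by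
  simp only [Finset.sum_mul]
  rw [Finset.sum_congr rfl fun _ _ => Finset.sum_comm, Finset.sum_comm]
  refine Finset.sum_congr rfl fun i _ => ?_
  rw [Finset.sum_eq_single (a i), Finset.sum_eq_single (b i)]
  · simp
  · intro x _ h
    simp [h.symm]
  · simp
  · intro x _ h
    simp [h.symm]
  · simp

/-- Probability that the input sequences `x₁`, `x₂` lead to a decoding error. -/
def inputError {X₁ X₂ Y₁ Y₂ : Type} [Fintype Y₁] [Fintype Y₂] {n M₁ M₂ : ℕ}
    (W : X₁ → X₂ → Y₁ → Y₂ → ℝ) (d₁ : (Fin n → Y₁) → Option (Fin M₁))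
    (d₂ : (Fin n → Y₂) → Option (Fin M₂)) (m₁ : Fin M₁) (m₂ : Fin M₂)
    (x₁ : Fin n → X₁) (x₂ : Fin n → X₂) : ℝ :=
  ∑ y₁ : Fin n → Y₁, ∑ y₂ : Fin n → Y₂, (∏ t, W (x₁ t) (x₂ t) (y₁ t) (y₂ t)) *
    (if d₁ y₁ = some m₁ ∧ d₂ y₂ = some m₂ then 0 else 1)

theorem inputError_eq_one_sub {X₁ X₂ Y₁ Y₂ : Type} [Fintype Y₁] [Fintype Y₂] {n M₁ M₂ : ℕ}
    (W : InterferenceChannel X₁ X₂ Y₁ Y₂)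
    (d₁ : (Fin n → Y₁) → Option (Fin M₁)) (d₂ : (Fin n → Y₂) → Option (Fin M₂)) (m₁ : Fin M₁)
    (m₂ : Fin M₂) (x₁ : Fin n → X₁) (x₂ : Fin n → X₂) :
    inputError W.p d₁ d₂ m₁ m₂ x₁ x₂ = 1 - ∑ y₁ : Fin n → Y₁, ∑ y₂ : Fin n → Y₂,
      if d₁ y₁ = some m₁ ∧ d₂ y₂ = some m₂ then ∏ t, W.p (x₁ t) (x₂ t) (y₁ t) (y₂ t) else 0 := by
  have h : ∑ y₁ : Fin n → Y₁, ∑ y₂ : Fin n → Y₂, ∏ t, W.p (x₁ t) (x₂ t) (y₁ t) (y₂ t) = 1 := by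
    rw [sum_prod_pi₂ fun t => W.p (x₁ t) (x₂ t)]
    simp [W.sum_one]
  rw [← h, inputError]
  simp only [← Finset.sum_sub_distrib]
  refine Finset.sum_congr rfl fun _ _ => Finset.sum_congr rfl fun _ _ => ?_
  split_ifs <;> simp

section ErrorProb

variable {X₁ X₂ Y₁ Y₂ : Type} [Fintype X₁] [Fintype X₂] [Fintype Y₁] [Fintype Y₂]
  [DecidableEq X₁] [DecidableEq X₂] {n M₁ M₂ : ℕ}

/-- Error probability of an encoding that chooses the pair of codewords through a random index. -/
theorem errorProb_eq (W : InterferenceChannel X₁ X₂ Y₁ Y₂) (C : Code X₁ X₂ Y₁ Y₂ n M₁ M₂)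
    {ι : Type} [Fintype ι] (w : Fin M₁ → Fin M₂ → ι → ℝ) (a : Fin M₁ → ι → Fin n → X₁)
    (b : Fin M₂ → ι → Fin n → X₂)
    (h : ∀ m₁ m₂ x₁ x₂, C.enc m₁ m₂ x₁ x₂
      = ∑ i, if a m₁ i = x₁ ∧ b m₂ i = x₂ then w m₁ m₂ i else 0) :
    C.errorProb W = (∑ m₁, ∑ m₂, ∑ i, w m₁ m₂ i *
      inputError W.p C.dec₁ C.dec₂ m₁ m₂ (a m₁ i) (b m₂ i)) / ((M₁ : ℝ) * M₂) := by
  unfold Code.errorProb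
  congr 1
  refine Finset.sum_congr rfl fun m₁ _ => Finset.sum_congr rfl fun m₂ _ => ?_
  rw [← sum_ite_pair_mul (w m₁ m₂) (a m₁) (b m₂)]
  refine Finset.sum_congr rfl fun x₁ _ => Finset.sum_congr rfl fun x₂ _ => ?_
  rw [← h, inputError]
  simp only [Finset.mul_sum, mul_assoc]

/-- A shared random choice is never better than the best deterministic one. -/
theorem exists_correctProb_ge (W : InterferenceChannel X₁ X₂ Y₁ Y₂) (C : Code X₁ X₂ Y₁ Y₂ n M₁ M₂)
    (hM₁ : 0 < M₁) (hM₂ : 0 < M₂) (hC : C.enc ∈ classicalStrategies n M₁ M₂) :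
    ∃ (f₁ : Fin M₁ → Fin n → X₁) (f₂ : Fin M₂ → Fin n → X₂),
      1 - C.errorProb W ≤ correctProb W.p f₁ f₂ C.dec₁ C.dec₂ := by
  obtain ⟨k, w, f₁, f₂, hw, hw1, hQ⟩ := hC
  have e := errorProb_eq W C (fun _ _ => w) (fun m i => f₁ i m) (fun m i => f₂ i m) hQ
  have hM : (M₁ : ℝ) * M₂ ≠ 0 := by positivity
  have e2 : ∀ i, (∑ m₁, ∑ m₂, inputError W.p C.dec₁ C.dec₂ m₁ m₂ (f₁ i m₁) (f₂ i m₂))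
      / ((M₁ : ℝ) * M₂) = 1 - correctProb W.p (f₁ i) (f₂ i) C.dec₁ C.dec₂ := by
    intro i
    simp only [inputError_eq_one_sub, Finset.sum_sub_distrib, sub_div, correctProb]
    simp [hM]
  have e3 : C.errorProb W = ∑ i, w i * (1 - correctProb W.p (f₁ i) (f₂ i) C.dec₁ C.dec₂) := by
    rw [e]
    simp only [← e2, Finset.mul_sum, mul_div_assoc']
    rw [← Finset.sum_div]
    congr 1
    rw [Finset.sum_congr rfl fun _ _ => Finset.sum_comm, Finset.sum_comm]
  by_contra! hcon
  have h4 : ∑ i, w i * (C.errorProb W) ≤ ∑ i, w i * (1 - correctProb W.p (f₁ i) (f₂ i) C.dec₁ C.dec₂) :=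
    Finset.sum_le_sum fun i _ => mul_le_mul_of_nonneg_left (by linarith [hcon (f₁ i) (f₂ i)]) (hw i)
  obtain ⟨i, hi⟩ : ∃ i, 0 < w i := by
    by_contra! h
    have : ∑ i, w i ≤ 0 := Finset.sum_nonpos fun i _ => h i
    linarith
  have h5 : ∑ i, w i * (C.errorProb W) < ∑ i, w i * (1 - correctProb W.p (f₁ i) (f₂ i) C.dec₁ C.dec₂) :=
    Finset.sum_lt_sum (fun i _ => mul_le_mul_of_nonneg_left (by linarith [hcon (f₁ i) (f₂ i)]) (hw i))
      ⟨i, Finset.mem_univ i, mul_lt_mul_of_pos_left (by linarith [hcon (f₁ i) (f₂ i)]) hi⟩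
  rw [← e3, ← Finset.sum_mul, hw1, one_mul] at h5
  exact lt_irrefl _ h5

end ErrorProb

theorem natCeil_two_rpow_pos (x : ℝ) : 0 < ⌈(2 : ℝ) ^ x⌉₊ :=
  Nat.ceil_pos.2 (Real.rpow_pos_of_pos two_pos _)

theorem classical_sumRate_le {ε : ℝ} (hε : ε ∈ Set.Icc (0 : ℝ) 1) (h0 : 0 < ε) (h1 : ε ≤ 1 / 2)
    {R₁ R₂ : ℝ} (h : Achievable (channelII ε hε) classicalStrategies R₁ R₂) :
    (R₁ + R₂) * Real.log 2 ≤ 1.183 * ε + 2 * ε ^ 2 := by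
  obtain ⟨hR₁, hR₂, C, hC, hlim⟩ := h
  have hl2 : 0 < Real.log 2 := Real.log_pos one_lt_two
  have key : ∀ n : ℕ, 0 < n → (1 - (C n).errorProb (channelII ε hε)) * ((R₁ + R₂) * Real.log 2)
      ≤ Real.log 2 / n + (1.183 * ε + 2 * ε ^ 2) := by
    intro n hn
    have hn' : (0 : ℝ) < n := by exact_mod_cast hn
    -- If the success probability is not positive the bound is trivial; otherwise a deterministic
    -- code does at least as well.
    rcases le_or_gt (1 - (C n).errorProb (channelII ε hε)) 0 with hneg | hpos
    · have : (1 - (C n).errorProb (channelII ε hε)) * ((R₁ + R₂) * Real.log 2) ≤ 0 :=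
        mul_nonpos_of_nonpos_of_nonneg hneg (by positivity)
      have : 0 ≤ Real.log 2 / n + (1.183 * ε + 2 * ε ^ 2) := by positivity
      linarith
    have hM₁ := natCeil_two_rpow_pos (n * R₁)
    have hM₂ := natCeil_two_rpow_pos (n * R₂)
    obtain ⟨f₁, f₂, hf⟩ := exists_correctProb_ge (channelII ε hε) (C n) hM₁ hM₂ (hC n)
    have hb := correctProb_mul_log_le hε h0 h1 hM₁ hM₂ f₁ f₂ (C n).dec₁ (C n).dec₂
    have hlog : n * ((R₁ + R₂) * Real.log 2) ≤
        Real.log ((⌈(2 : ℝ) ^ ((n : ℝ) * R₁)⌉₊ : ℝ) * ⌈(2 : ℝ) ^ ((n : ℝ) * R₂)⌉₊) := by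
      rw [Real.log_mul (by positivity) (by positivity)]
      have l : ∀ R : ℝ, n * R * Real.log 2 ≤ Real.log (⌈(2 : ℝ) ^ ((n : ℝ) * R)⌉₊ : ℝ) := by
        intro R
        rw [← Real.log_rpow two_pos]
        exact Real.log_le_log (by positivity) (Nat.le_ceil _)
      linarith [l R₁, l R₂]
    have hlog0 : 0 ≤ n * ((R₁ + R₂) * Real.log 2) := by positivity
    have h2 := (mul_le_mul_of_nonneg_left hlog hpos.le).trans
      ((mul_le_mul_of_nonneg_right hf (hlog0.trans hlog)).trans hb)
    rw [← sub_nonneg] at h2 ⊢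
    have e : Real.log 2 / n + (1.183 * ε + 2 * ε ^ 2)
        - (1 - (C n).errorProb (channelII ε hε)) * ((R₁ + R₂) * Real.log 2)
        = (Real.log 2 + n * (1.183 * ε + 2 * ε ^ 2)
        - (1 - (C n).errorProb (channelII ε hε)) * (n * ((R₁ + R₂) * Real.log 2))) / n := by
      field_simp
    rw [e]
    exact div_nonneg h2 hn'.le
  have t1 : Filter.Tendsto (fun n : ℕ => (1 - (C n).errorProb (channelII ε hε)) *
      ((R₁ + R₂) * Real.log 2)) Filter.atTop (nhds ((1 - 0) * ((R₁ + R₂) * Real.log 2))) :=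
    (tendsto_const_nhds.sub hlim).mul_const _
  have t2 : Filter.Tendsto (fun n : ℕ => Real.log 2 / n + (1.183 * ε + 2 * ε ^ 2)) Filter.atTop
      (nhds (0 + (1.183 * ε + 2 * ε ^ 2))) :=
    (tendsto_const_div_atTop_nhds_zero_nat _).add_const _
  have := le_of_tendsto_of_tendsto t1 t2
    (Filter.eventually_atTop.2 ⟨1, fun n hn => key n hn⟩)
  simpa using this

theorem classical_sumCapacity_le {ε : ℝ} (hε : ε ∈ Set.Icc (0 : ℝ) 1) (h0 : 0 < ε)
    (h1 : ε ≤ 1 / 2) :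
    sumCapacity (channelII ε hε) classicalStrategies
      ≤ (((1.183 * ε + 2 * ε ^ 2) / Real.log 2 : ℝ) : EReal) := by
  refine sSup_le ?_
  rintro _ ⟨R₁, R₂, h, rfl⟩
  rw [EReal.coe_le_coe_iff, le_div_iff₀ (Real.log_pos one_lt_two)]
  exact classical_sumRate_le hε h0 h1 h

/-! ### Random codes for the erasure channel -/

section ErasureCode

variable {n M : ℕ}

/-- Some other message has the same codeword on the positions `E` that are not erased. -/
def Confusable (F : Fin n → Fin M → Bool) (E : Fin n → Bool) (m : Fin M) : Prop :=
  ∃ m', m' ≠ m ∧ ∀ t, E t = true → F t m' = F t m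

/-- Probability of the pattern `E` of positions that are not erased. -/
def patternProb (δ : ℝ) (E : Fin n → Bool) : ℝ := ∏ t, if E t then δ else 1 - δ

open Classical in
/-- Probability of ambiguity for the code `F` on the erasure channel. -/
def ambiguity (δ : ℝ) (F : Fin n → Fin M → Bool) : ℝ :=
  (∑ m, ∑ E : Fin n → Bool, patternProb δ E * if Confusable F E m then 1 else 0) / M

theorem patternProb_nonneg {δ : ℝ} (hδ : δ ∈ Set.Icc (0 : ℝ) 1) (E : Fin n → Bool) :
    0 ≤ patternProb δ E := by
  refine Finset.prod_nonneg fun t _ => ?_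
  split_ifs
  · exact hδ.1
  · linarith [hδ.2]

theorem ambiguity_nonneg {δ : ℝ} (hδ : δ ∈ Set.Icc (0 : ℝ) 1) (F : Fin n → Fin M → Bool) :
    0 ≤ ambiguity δ F := by
  refine div_nonneg (Finset.sum_nonneg fun m _ => Finset.sum_nonneg fun E _ =>
    mul_nonneg (patternProb_nonneg hδ E) ?_) (Nat.cast_nonneg _)
  split_ifs <;> norm_num

theorem sum_ite_eq_coord {m m' : Fin M} (h : m' ≠ m) :
    ∑ c : Fin M → Bool, (if c m' = c m then (1 : ℝ) else 0) = 1 / 2 * 2 ^ M := by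
  have h1 : ∑ c : Fin M → Bool, (if c m' = c m then (1 : ℝ) else 0)
      = ∑ c : Fin M → Bool, if c m' = c m then (0 : ℝ) else 1 := by
    -- Flipping the bit at $m$ exchanges agreement and disagreement with $m'$.
    refine Finset.sum_bij' (fun c _ => Function.update c m (!(c m)))
      (fun c _ => Function.update c m (!(c m))) (by simp) (by simp) (by simp) (by simp) ?_
    intro c _
    simp only [Function.update_self, Function.update_of_ne h]
    cases c m' <;> cases c m <;> simp
  have h2 : ∑ c : Fin M → Bool, (if c m' = c m then (1 : ℝ) else 0)
      + ∑ c : Fin M → Bool, (if c m' = c m then (0 : ℝ) else 1) = 2 ^ M := by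
    rw [← Finset.sum_add_distrib]
    have : ∀ c : Fin M → Bool, (if c m' = c m then (1 : ℝ) else 0)
        + (if c m' = c m then (0 : ℝ) else 1) = 1 := by
      intro c; split_ifs <;> norm_num
    simp [this]
  linarith

theorem sum_agree {m m' : Fin M} (h : m' ≠ m) (E : Fin n → Bool) :
    ∑ F : Fin n → Fin M → Bool, (if ∀ t, E t = true → F t m' = F t m then (1 : ℝ) else 0)
      = (∏ t, if E t then (1 / 2 : ℝ) else 1) * (2 ^ M) ^ n := by
  have e : ∀ F : Fin n → Fin M → Bool,
      (if ∀ t, E t = true → F t m' = F t m then (1 : ℝ) else 0)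
        = ∏ t, if E t = true → F t m' = F t m then (1 : ℝ) else 0 := by
    intro F
    split_ifs with hF
    · exact (Finset.prod_eq_one fun t _ => if_pos (hF t)).symm
    · push Not at hF
      obtain ⟨t, ht⟩ := hF
      exact (Finset.prod_eq_zero (Finset.mem_univ t) (if_neg (by tauto))).symm
  simp only [e]
  rw [sum_prod_pi fun t (c : Fin M → Bool) => if E t = true → c m' = c m then (1 : ℝ) else 0]
  have e2 : ∀ t, ∑ c : Fin M → Bool, (if E t = true → c m' = c m then (1 : ℝ) else 0)
      = (if E t then (1 / 2 : ℝ) else 1) * 2 ^ M := by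
    intro t
    cases E t
    · simp
    · simpa using sum_ite_eq_coord h
  simp only [e2, Finset.prod_mul_distrib]
  simp

theorem le_rpow_of_le_one_of_le {A u s : ℝ} (hA : A ≤ 1) (hAu : A ≤ u) (hu : 0 ≤ u)
    (hs0 : 0 < s) (hs1 : s ≤ 1) : A ≤ u ^ s := by
  rcases le_total 1 u with h | h
  · exact hA.trans (Real.one_le_rpow h hs0.le)
  · refine hAu.trans ?_
    rcases hu.eq_or_lt with rfl | hu
    · rw [Real.zero_rpow hs0.ne']
    · simpa using Real.rpow_le_rpow_of_exponent_ge hu h hs1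

open Classical in
-- The fraction of confusable codes is at most 1 and, by the union bound, at most $u=(M-1)2^{-|E|}$,
-- hence at most $u^s$. The factor $M-1$ in place of $M$ makes the bound vanish for a single
-- message.
theorem sum_confusable_le (m : Fin M) (E : Fin n → Bool) {s : ℝ} (hs0 : 0 < s) (hs1 : s ≤ 1) :
    ∑ F : Fin n → Fin M → Bool, (if Confusable F E m then (1 : ℝ) else 0)
      ≤ ((M - 1 : ℕ) : ℝ) ^ s * (∏ t, if E t then (1 / 2 : ℝ) ^ s else 1) * (2 ^ M) ^ n := by
  have hN : (0 : ℝ) < (2 ^ M) ^ n := by positivity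
  have hx : (0 : ℝ) ≤ ∏ t, if E t then (1 / 2 : ℝ) else 1 :=
    Finset.prod_nonneg fun t _ => by split_ifs <;> norm_num
  have hpow : ((M - 1 : ℕ) : ℝ) ^ s * (∏ t, if E t then (1 / 2 : ℝ) ^ s else 1)
      = (((M - 1 : ℕ) : ℝ) * ∏ t, if E t then (1 / 2 : ℝ) else 1) ^ s := by
    rw [Real.mul_rpow (Nat.cast_nonneg _) hx,
      ← Real.finsetProd_rpow _ _ fun t _ => by split_ifs <;> norm_num]
    congr 1
    refine Finset.prod_congr rfl fun t _ => ?_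
    split_ifs
    · rfl
    · rw [Real.one_rpow]
  rw [hpow, ← div_le_iff₀ hN]
  refine le_rpow_of_le_one_of_le ?_ ?_ (mul_nonneg (Nat.cast_nonneg _) hx) hs0 hs1
  · rw [div_le_one hN]
    calc _ ≤ ∑ F : Fin n → Fin M → Bool, (1 : ℝ) :=
          Finset.sum_le_sum fun F _ => by split_ifs <;> norm_num
      _ = (2 ^ M) ^ n := by simp
  · rw [div_le_iff₀ hN]
    calc _ ≤ ∑ F : Fin n → Fin M → Bool, ∑ m' ∈ Finset.univ.erase m,
            (if ∀ t, E t = true → F t m' = F t m then (1 : ℝ) else 0) := by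
          refine Finset.sum_le_sum fun F _ => ?_
          have h0 : ∀ m' ∈ Finset.univ.erase m,
              (0 : ℝ) ≤ if ∀ t, E t = true → F t m' = F t m then (1 : ℝ) else 0 :=
            fun m' _ => by split_ifs <;> norm_num
          split_ifs with h
          · obtain ⟨m', hm', hF⟩ := h
            have := Finset.single_le_sum h0 (Finset.mem_erase.2 ⟨hm', Finset.mem_univ m'⟩)
            rwa [if_pos hF] at this
          · exact Finset.sum_nonneg h0
      _ = ∑ m' ∈ Finset.univ.erase m, (∏ t, if E t then (1 / 2 : ℝ) else 1) * (2 ^ M) ^ n := by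
          rw [Finset.sum_comm]
          exact Finset.sum_congr rfl fun m' hm' => sum_agree (Finset.ne_of_mem_erase hm') E
      _ = _ := by
          rw [Finset.sum_const, Finset.card_erase_of_mem (Finset.mem_univ m), Finset.card_univ,
            Fintype.card_fin, nsmul_eq_mul, mul_assoc]

/-- Random coding bound for the erasure channel. -/
theorem exists_ambiguity_le {δ : ℝ} (hδ : δ ∈ Set.Icc (0 : ℝ) 1) (hM : 0 < M) {s : ℝ}
    (hs0 : 0 < s) (hs1 : s ≤ 1) :
    ∃ F : Fin n → Fin M → Bool,
      ambiguity δ F ≤ ((M - 1 : ℕ) : ℝ) ^ s * (1 - δ + δ * (1 / 2) ^ s) ^ n := by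
  classical
  have key : ∑ F : Fin n → Fin M → Bool, ambiguity δ F
      ≤ ∑ F : Fin n → Fin M → Bool, ((M - 1 : ℕ) : ℝ) ^ s * (1 - δ + δ * (1 / 2) ^ s) ^ n := by
    have e1 : ∑ F : Fin n → Fin M → Bool, ambiguity δ F
        = (∑ m : Fin M, ∑ E : Fin n → Bool, patternProb δ E *
          ∑ F : Fin n → Fin M → Bool, if Confusable F E m then (1 : ℝ) else 0) / M := by
      simp only [ambiguity, ← Finset.sum_div, Finset.mul_sum]
      congr 1
      rw [Finset.sum_comm]
      refine Finset.sum_congr rfl fun m _ => ?_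
      rw [Finset.sum_comm]
    have hMr : (0 : ℝ) < M := by exact_mod_cast hM
    rw [e1, div_le_iff₀ hMr]
    calc _ ≤ ∑ m : Fin M, ∑ E : Fin n → Bool, patternProb δ E * (((M - 1 : ℕ) : ℝ) ^ s *
            (∏ t, if E t then (1 / 2 : ℝ) ^ s else 1) * (2 ^ M) ^ n) :=
          Finset.sum_le_sum fun m _ => Finset.sum_le_sum fun E _ =>
            mul_le_mul_of_nonneg_left (sum_confusable_le m E hs0 hs1) (patternProb_nonneg hδ E)
      _ = ∑ m : Fin M, ((M - 1 : ℕ) : ℝ) ^ s * (1 - δ + δ * (1 / 2) ^ s) ^ n * (2 ^ M) ^ n := by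
          refine Finset.sum_congr rfl fun m _ => ?_
          have e2 : ∑ E : Fin n → Bool, patternProb δ E * (∏ t, if E t then (1 / 2 : ℝ) ^ s else 1)
              = (1 - δ + δ * (1 / 2) ^ s) ^ n := by
            simp only [patternProb, ← Finset.prod_mul_distrib]
            rw [sum_prod_pi fun _ (e : Bool) => (if e then δ else 1 - δ) *
              if e then (1 / 2 : ℝ) ^ s else 1]
            simp [add_comm]
          rw [← e2, Finset.mul_sum, Finset.sum_mul]
          refine Finset.sum_congr rfl fun E _ => ?_
          ring
      _ = _ := by
          simp only [Finset.sum_const, Finset.card_univ, Fintype.card_fin, Fintype.card_fun,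
            Fintype.card_bool, nsmul_eq_mul, Nat.cast_pow, Nat.cast_ofNat]
          ring
  obtain ⟨F, -, hF⟩ := Finset.exists_le_of_sum_le Finset.univ_nonempty key
  exact ⟨F, hF⟩

end ErasureCode

/-- To first order in $s$ the logarithm of the product is $(R-\delta)s\ln2<0$; the choice
$s=(\delta-R)/2$ is already small enough. -/
theorem exists_exponent {δ R : ℝ} (hδ : δ ≤ 1) (hR : 0 ≤ R) (h : R < δ) :
    ∃ s : ℝ, 0 < s ∧ s ≤ 1 ∧ (2 : ℝ) ^ (R * s) * (1 - δ + δ * (1 / 2) ^ s) < 1 := by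
  refine ⟨(δ - R) / 2, by linarith, by linarith, ?_⟩
  set s := (δ - R) / 2 with hs
  have hs0 : 0 < s := by linarith
  have hl : 0 < Real.log 2 := Real.log_pos one_lt_two
  set u := Real.log 2 * s with hu
  have hu0 : 0 < u := mul_pos hl hs0
  have hus : u ≤ s := by
    have := Real.log_two_lt_d9
    nlinarith
  have e1 : (2 : ℝ) ^ (R * s) = Real.exp (R * u) := by
    rw [Real.rpow_def_of_pos two_pos, hu]; ring_nf
  have e2 : (1 / 2 : ℝ) ^ s = (Real.exp u)⁻¹ := by
    rw [one_div, Real.inv_rpow two_pos.le, Real.rpow_def_of_pos two_pos]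
  have hinv : (Real.exp u)⁻¹ ≤ (1 + u)⁻¹ :=
    inv_anti₀ (by linarith) (by linarith [Real.add_one_le_exp u])
  have e3 : 1 - δ + δ * (1 + u)⁻¹ = -(δ * (u / (1 + u))) + 1 := by
    field_simp; ring
  have hb : 1 - δ + δ * (Real.exp u)⁻¹ ≤ Real.exp (-(δ * (u / (1 + u)))) := by
    have h1 := mul_le_mul_of_nonneg_left hinv (hR.trans h.le)
    have h2 := Real.add_one_le_exp (-(δ * (u / (1 + u))))
    linarith
  rw [e1, e2]
  refine (mul_le_mul_of_nonneg_left hb (Real.exp_pos _).le).trans_lt ?_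
  rw [← Real.exp_add, Real.exp_lt_one_iff]
  have e4 : R * u + -(δ * (u / (1 + u))) = -((δ - R - R * u) * (u / (1 + u))) := by
    field_simp; ring
  rw [e4, neg_lt_zero]
  refine mul_pos ?_ (by positivity)
  -- $Ru\le u\le s=(\delta-R)/2<\delta-R$, using $R<1$.
  nlinarith

/-- Rates below the capacity of the erasure channel. -/
theorem exists_codes {δ R : ℝ} (hδ : δ ∈ Set.Icc (0 : ℝ) 1) (hR : 0 ≤ R) (h : R < δ ∨ R = 0) :
    ∃ F : ∀ n : ℕ, Fin n → Fin ⌈(2 : ℝ) ^ ((n : ℝ) * R)⌉₊ → Bool,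
      Filter.Tendsto (fun n => ambiguity δ (F n)) Filter.atTop (nhds 0) := by
  suffices hs : ∃ q : ℝ, 0 ≤ q ∧ q < 1 ∧ ∀ n : ℕ,
      ∃ F : Fin n → Fin ⌈(2 : ℝ) ^ ((n : ℝ) * R)⌉₊ → Bool, ambiguity δ F ≤ q ^ n by
    obtain ⟨q, hq0, hq1, hq⟩ := hs
    choose F hF using hq
    exact ⟨F, squeeze_zero (fun n => ambiguity_nonneg hδ _) hF
      (tendsto_pow_atTop_nhds_zero_of_lt_one hq0 hq1)⟩
  rcases h with h | rfl
  · obtain ⟨s, hs0, hs1, hs⟩ := exists_exponent hδ.2 hR h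
    have hb : 0 ≤ 1 - δ + δ * (1 / 2 : ℝ) ^ s := by
      have h1 : 0 ≤ 1 - δ := by linarith [hδ.2]
      have h2 : 0 ≤ δ := hδ.1
      positivity
    refine ⟨_, by positivity, hs, fun n => ?_⟩
    have hM := natCeil_two_rpow_pos (n * R)
    obtain ⟨F, hF⟩ := exists_ambiguity_le (n := n) hδ hM hs0 hs1
    refine ⟨F, hF.trans ?_⟩
    rw [mul_pow]
    refine mul_le_mul_of_nonneg_right ?_ (by positivity)
    rw [← Real.rpow_natCast, ← Real.rpow_mul two_pos.le,
      show R * s * (n : ℝ) = n * R * s by ring, Real.rpow_mul two_pos.le (n * R)]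
    refine Real.rpow_le_rpow (Nat.cast_nonneg _) ?_ hs0.le
    -- One less than the ceiling is at most $2^{nR}$, so rounding up costs nothing.
    have h1 := Nat.ceil_lt_add_one (Real.rpow_pos_of_pos two_pos ((n : ℝ) * R)).le
    rw [Nat.cast_sub hM, Nat.cast_one]
    linarith
  -- At rate 0 there is one message and no ambiguity, even when $\delta=0$.
  · refine ⟨0, le_rfl, one_pos, fun n => ?_⟩
    obtain ⟨F, hF⟩ := exists_ambiguity_le (n := n) hδ (natCeil_two_rpow_pos (n * 0)) one_pos le_rfl
    refine ⟨F, hF.trans ?_⟩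
    have : ⌈(2 : ℝ) ^ ((n : ℝ) * 0)⌉₊ - 1 = 0 := by simp
    rw [this]
    simp only [Nat.cast_zero, Real.rpow_one, zero_mul]
    positivity

/-! ### Erasure channels from a CHSH box -/

/-- Output of the erasure channel. -/
def erase (e b : Bool) : Option Bool := if e then some b else none

open Classical in
/-- The decoder that returns the message if it is determined by the symbols received. -/
def uniqueDec {n M : ℕ} (F : Fin n → Fin M → Bool) (y : Fin n → Option Bool) : Option (Fin M) :=
  if h : ∃! m, ∀ t b, y t = some b → F t m = b then some h.choose else none

theorem uniqueDec_erase {n M : ℕ} {F : Fin n → Fin M → Bool} {E : Fin n → Bool} {m : Fin M}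
    (h : ¬ Confusable F E m) : uniqueDec F (fun t => erase (E t) (F t m)) = some m := by
  have hm : ∀ t b, erase (E t) (F t m) = some b → F t m = b := by
    intro t b
    cases hE : E t <;> simp [erase]
  have hu : ∀ m', (∀ t b, erase (E t) (F t m) = some b → F t m' = b) → m' = m := by
    intro m' hm'
    by_contra hne
    exact h ⟨m', hne, fun t ht => hm' t _ (by simp [erase, ht])⟩
  have hex : ∃! m', ∀ t b, erase (E t) (F t m) = some b → F t m' = b := ⟨m, hm, hu⟩
  rw [uniqueDec, dif_pos hex, Option.some.injEq]
  exact hu _ hex.choose_spec.1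

/-- The senders use the box `P` once per channel use: on the bits `F₁ t m₁`, `F₂ t m₂` it returns
the second bits of the inputs. -/
def boxBehaviour {n M₁ M₂ : ℕ} (P : Bool → Bool → Bool → Bool → ℝ)
    (F₁ : Fin n → Fin M₁ → Bool) (F₂ : Fin n → Fin M₂ → Bool) :
    Behaviour (Bool × Bool) (Bool × Bool) n M₁ M₂ := fun m₁ m₂ x₁ x₂ =>
  ∑ a : Fin n → Bool, ∑ b : Fin n → Bool,
    if (fun t => (F₁ t m₁, a t)) = x₁ ∧ (fun t => (F₂ t m₂, b t)) = x₂ then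
      ∏ t, P (F₁ t m₁) (F₂ t m₂) (a t) (b t) else 0

/-- Because the box wins with the same probability on all four pairs of bits, the erasure is
independent of the bits sent. It is common to both receivers. -/
theorem sum_box_mul_channelIIProb {ε κ : ℝ} {P : Bool → Bool → Bool → Bool → ℝ}
    (hP : ∀ u v, ∑ a, ∑ b, P u v a b = 1)
    (hκ : ∀ u v, P u v false (u && v) + P u v true (!(u && v)) = κ) (u v : Bool)
    (y₁ y₂ : Option Bool) :
    ∑ a, ∑ b, P u v a b * channelIIProb ε (u, a) (v, b) y₁ y₂
      = ∑ e, (if e then κ * ε else 1 - κ * ε) *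
        if erase e u = y₁ ∧ erase e v = y₂ then 1 else 0 := by
  have h1 := hP u v
  have h2 := hκ u v
  simp only [Fintype.sum_bool] at h1 ⊢
  simp only [channelIIProb_eq, erase]
  have h3 : (κ * ε) = (P u v false (u && v) + P u v true (!(u && v))) * ε := by rw [h2]
  rw [h3]
  obtain _ | _ | _ := y₁ <;> obtain _ | _ | _ := y₂ <;> cases u <;> cases v <;>
    simp [partner] at h1 ⊢ <;> first | linear_combination h1 | ring

theorem sum_box_mul_inputError {ε κ : ℝ} {P : Bool → Bool → Bool → Bool → ℝ}
    (hP : ∀ u v, ∑ a, ∑ b, P u v a b = 1)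
    (hκ : ∀ u v, P u v false (u && v) + P u v true (!(u && v)) = κ) {n M₁ M₂ : ℕ}
    (F₁ : Fin n → Fin M₁ → Bool) (F₂ : Fin n → Fin M₂ → Bool)
    (d₁ : (Fin n → Option Bool) → Option (Fin M₁)) (d₂ : (Fin n → Option Bool) → Option (Fin M₂))
    (m₁ : Fin M₁) (m₂ : Fin M₂) :
    ∑ a : Fin n → Bool, ∑ b : Fin n → Bool, (∏ t, P (F₁ t m₁) (F₂ t m₂) (a t) (b t)) *
      inputError (channelIIProb ε) d₁ d₂ m₁ m₂ (fun t => (F₁ t m₁, a t)) (fun t => (F₂ t m₂, b t))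
    = ∑ E : Fin n → Bool, patternProb (κ * ε) E *
      if d₁ (fun t => erase (E t) (F₁ t m₁)) = some m₁ ∧
        d₂ (fun t => erase (E t) (F₂ t m₂)) = some m₂ then 0 else 1 := by
  let G : (Fin n → Option Bool) → (Fin n → Option Bool) → ℝ := fun y₁ y₂ =>
    if d₁ y₁ = some m₁ ∧ d₂ y₂ = some m₂ then 0 else 1
  have lhs : ∑ a : Fin n → Bool, ∑ b : Fin n → Bool, (∏ t, P (F₁ t m₁) (F₂ t m₂) (a t) (b t)) *
      inputError (channelIIProb ε) d₁ d₂ m₁ m₂ (fun t => (F₁ t m₁, a t)) (fun t => (F₂ t m₂, b t))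
      = ∑ y₁, ∑ y₂, (∑ a : Fin n → Bool, ∑ b : Fin n → Bool,
        ∏ t, P (F₁ t m₁) (F₂ t m₂) (a t) (b t) *
          channelIIProb ε (F₁ t m₁, a t) (F₂ t m₂, b t) (y₁ t) (y₂ t)) * G y₁ y₂ := by
    simp only [inputError, Finset.mul_sum, Finset.sum_mul, Finset.prod_mul_distrib, mul_assoc, G]
    have sw : ∀ (g : (Fin n → Bool) → (Fin n → Bool) → (Fin n → Option Bool) →
        (Fin n → Option Bool) → ℝ), ∑ a, ∑ b, ∑ y₁, ∑ y₂, g a b y₁ y₂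
          = ∑ y₁, ∑ y₂, ∑ a, ∑ b, g a b y₁ y₂ := by
      intro g
      rw [Finset.sum_congr rfl fun a _ => Finset.sum_comm, Finset.sum_comm]
      refine Finset.sum_congr rfl fun y₁ _ => ?_
      rw [Finset.sum_congr rfl fun a _ => Finset.sum_comm, Finset.sum_comm]
    exact sw _
  rw [lhs]
  have mid : ∀ y₁ y₂ : Fin n → Option Bool, ∑ a : Fin n → Bool, ∑ b : Fin n → Bool,
        ∏ t, P (F₁ t m₁) (F₂ t m₂) (a t) (b t) *
          channelIIProb ε (F₁ t m₁, a t) (F₂ t m₂, b t) (y₁ t) (y₂ t)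
      = ∑ E : Fin n → Bool, if (fun t => erase (E t) (F₁ t m₁)) = y₁ ∧
          (fun t => erase (E t) (F₂ t m₂)) = y₂ then patternProb (κ * ε) E else 0 := by
    intro y₁ y₂
    rw [sum_prod_pi₂ fun t a b => P (F₁ t m₁) (F₂ t m₂) a b *
      channelIIProb ε (F₁ t m₁, a) (F₂ t m₂, b) (y₁ t) (y₂ t)]
    simp only [sum_box_mul_channelIIProb hP hκ]
    rw [← sum_prod_pi]
    refine Finset.sum_congr rfl fun E _ => ?_
    rw [Finset.prod_mul_distrib, ← patternProb]
    split_ifs with h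
    · rw [Finset.prod_eq_one, mul_one]
      intro t _
      exact if_pos ⟨congrFun h.1 t, congrFun h.2 t⟩
    · simp only [funext_iff, ← forall_and] at h
      push Not at h
      obtain ⟨t, ht⟩ := h
      rw [Finset.prod_eq_zero (Finset.mem_univ t) (if_neg (by tauto)), mul_zero]
  simp only [mid]
  exact sum_ite_pair_mul _ _ _ G

theorem errorProb_box_eq {ε κ : ℝ} (hε : ε ∈ Set.Icc (0 : ℝ) 1)
    {P : Bool → Bool → Bool → Bool → ℝ} (hP : ∀ u v, ∑ a, ∑ b, P u v a b = 1)
    (hκ : ∀ u v, P u v false (u && v) + P u v true (!(u && v)) = κ) {n M₁ M₂ : ℕ}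
    (F₁ : Fin n → Fin M₁ → Bool) (F₂ : Fin n → Fin M₂ → Bool) :
    Code.errorProb ⟨boxBehaviour P F₁ F₂, uniqueDec F₁, uniqueDec F₂⟩ (channelII ε hε)
      = (∑ m₁, ∑ m₂, ∑ E : Fin n → Bool, patternProb (κ * ε) E *
        if uniqueDec F₁ (fun t => erase (E t) (F₁ t m₁)) = some m₁ ∧
          uniqueDec F₂ (fun t => erase (E t) (F₂ t m₂)) = some m₂ then 0 else 1)
        / ((M₁ : ℝ) * M₂) := by
  rw [errorProb_eq (channelII ε hε) ⟨boxBehaviour P F₁ F₂, uniqueDec F₁, uniqueDec F₂⟩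
    (ι := (Fin n → Bool) × (Fin n → Bool))
    (fun m₁ m₂ i => ∏ t, P (F₁ t m₁) (F₂ t m₂) (i.1 t) (i.2 t))
    (fun m i t => (F₁ t m, i.1 t)) (fun m i t => (F₂ t m, i.2 t))
    (fun m₁ m₂ x₁ x₂ => by simp only [boxBehaviour, Fintype.sum_prod_type])]
  congr 1
  refine Finset.sum_congr rfl fun m₁ _ => Finset.sum_congr rfl fun m₂ _ => ?_
  rw [Fintype.sum_prod_type]
  exact sum_box_mul_inputError hP hκ F₁ F₂ (uniqueDec F₁) (uniqueDec F₂) m₁ m₂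

open Classical in
theorem errorProb_box_le {ε κ : ℝ} (hε : ε ∈ Set.Icc (0 : ℝ) 1) (hδ : κ * ε ∈ Set.Icc (0 : ℝ) 1)
    {P : Bool → Bool → Bool → Bool → ℝ} (hP : ∀ u v, ∑ a, ∑ b, P u v a b = 1)
    (hκ : ∀ u v, P u v false (u && v) + P u v true (!(u && v)) = κ) {n M₁ M₂ : ℕ}
    (hM₁ : 0 < M₁) (hM₂ : 0 < M₂) (F₁ : Fin n → Fin M₁ → Bool) (F₂ : Fin n → Fin M₂ → Bool) :
    Code.errorProb ⟨boxBehaviour P F₁ F₂, uniqueDec F₁, uniqueDec F₂⟩ (channelII ε hε)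
      ≤ ambiguity (κ * ε) F₁ + ambiguity (κ * ε) F₂ := by
  rw [errorProb_box_eq hε hP hκ]
  have hM : (0 : ℝ) < (M₁ : ℝ) * M₂ := by positivity
  have e : ∀ m₁ m₂, ∑ E : Fin n → Bool, patternProb (κ * ε) E *
        (if uniqueDec F₁ (fun t => erase (E t) (F₁ t m₁)) = some m₁ ∧
          uniqueDec F₂ (fun t => erase (E t) (F₂ t m₂)) = some m₂ then 0 else 1)
      ≤ ∑ E : Fin n → Bool, patternProb (κ * ε) E * (if Confusable F₁ E m₁ then 1 else 0)
        + ∑ E : Fin n → Bool, patternProb (κ * ε) E * (if Confusable F₂ E m₂ then 1 else 0) := by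
    intro m₁ m₂
    rw [← Finset.sum_add_distrib]
    refine Finset.sum_le_sum fun E _ => ?_
    rw [← mul_add]
    refine mul_le_mul_of_nonneg_left ?_ (patternProb_nonneg hδ E)
    by_cases h₁ : Confusable F₁ E m₁
    · rw [if_pos h₁]
      split_ifs <;> norm_num
    by_cases h₂ : Confusable F₂ E m₂
    · rw [if_pos h₂]
      split_ifs <;> norm_num
    rw [if_pos ⟨uniqueDec_erase h₁, uniqueDec_erase h₂⟩, if_neg h₁, if_neg h₂, add_zero]
  refine (div_le_div_of_nonneg_right (Finset.sum_le_sum fun m₁ _ =>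
    Finset.sum_le_sum fun m₂ _ => e m₁ m₂) hM.le).trans (le_of_eq ?_)
  simp only [Finset.sum_add_distrib, Finset.sum_const, Finset.card_univ, Fintype.card_fin,
    nsmul_eq_mul, ambiguity, ← Finset.mul_sum]
  field_simp

/-- A class of strategies that contains independent uses of a box which wins the CHSH game with
probability `κ` on all inputs. -/
theorem le_sumCapacity_of_box {S : StrategyClass (Bool × Bool) (Bool × Bool)} {ε κ : ℝ}
    (hε : ε ∈ Set.Icc (0 : ℝ) 1) (hκ0 : 0 ≤ κ) (hκ1 : κ ≤ 1)
    {P : Bool → Bool → Bool → Bool → ℝ} (hP : ∀ u v, ∑ a, ∑ b, P u v a b = 1)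
    (hκ : ∀ u v, P u v false (u && v) + P u v true (!(u && v)) = κ)
    (hS : ∀ (n M₁ M₂ : ℕ) (F₁ : Fin n → Fin M₁ → Bool) (F₂ : Fin n → Fin M₂ → Bool),
      boxBehaviour P F₁ F₂ ∈ S n M₁ M₂) :
    ((2 * κ * ε : ℝ) : EReal) ≤ sumCapacity (channelII ε hε) S := by
  have hδ : κ * ε ∈ Set.Icc (0 : ℝ) 1 :=
    ⟨mul_nonneg hκ0 hε.1, mul_le_one₀ hκ1 hε.1 hε.2⟩
  have ach : ∀ R : ℝ, 0 ≤ R → (R < κ * ε ∨ R = 0) →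
      ((R + R : ℝ) : EReal) ≤ sumCapacity (channelII ε hε) S := by
    intro R hR h
    obtain ⟨F, hF⟩ := exists_codes hδ hR h
    refine le_sSup ⟨R, R, ⟨hR, hR, fun n => ⟨boxBehaviour P (F n) (F n), uniqueDec (F n),
      uniqueDec (F n)⟩, fun n => hS _ _ _ _ _, ?_⟩, rfl⟩
    refine squeeze_zero (fun n => ?_) (fun n => errorProb_box_le hε hδ hP hκ
      (natCeil_two_rpow_pos _) (natCeil_two_rpow_pos _) (F n) (F n)) (by simpa using hF.add hF)
    rw [errorProb_box_eq hε hP hκ]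
    refine div_nonneg (Finset.sum_nonneg fun _ _ => Finset.sum_nonneg fun _ _ =>
      Finset.sum_nonneg fun E _ => mul_nonneg (patternProb_nonneg hδ E) ?_) (by positivity)
    split_ifs <;> norm_num
  by_contra! hlt
  obtain ⟨x, hx1, hx2⟩ := EReal.lt_iff_exists_real_btwn.1 hlt
  rw [EReal.coe_lt_coe_iff] at hx2
  -- The rate 0 covers $x\le0$, and with it the case $\kappa\varepsilon=0$, where no rate below
  -- $\kappa\varepsilon$ is admissible.
  have h := ach (max (x / 2) 0) (le_max_right _ _) (by
    rcases le_total (x / 2) 0 with h | h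
    · exact Or.inr (max_eq_right h)
    · left
      rw [max_eq_left h]
      linarith)
  have hx3 : x ≤ max (x / 2) 0 + max (x / 2) 0 := by linarith [le_max_left (x / 2) 0]
  exact (hx1.trans_le (EReal.coe_le_coe_iff.2 hx3)).not_ge h

/-! ### Tensor powers of states and measurements -/

section PiMatrix

variable {n : ℕ} {A B : Type}

/-- The tensor product of the matrices `N t`. -/
def piMatrix (N : Fin n → Matrix A A ℂ) : Matrix (Fin n → A) (Fin n → A) ℂ :=
  Matrix.of fun u v => ∏ t, N t (u t) (v t)

theorem piMatrix_apply (N : Fin n → Matrix A A ℂ) (u v : Fin n → A) :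
    piMatrix N u v = ∏ t, N t (u t) (v t) := rfl

theorem complex_sum_prod_pi [Fintype A] (f : Fin n → A → ℂ) :
    ∑ y : Fin n → A, ∏ t, f t (y t) = ∏ t, ∑ a, f t a := by
  classical
  rw [Finset.prod_univ_sum, Fintype.piFinset_univ]

theorem piMatrix_mul [Fintype A] (N N' : Fin n → Matrix A A ℂ) :
    piMatrix N * piMatrix N' = piMatrix fun t => N t * N' t := by
  ext u v
  simp only [Matrix.mul_apply, piMatrix_apply, ← Finset.prod_mul_distrib]
  exact complex_sum_prod_pi fun t w => N t (u t) w * N' t w (v t)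

theorem conjTranspose_piMatrix (N : Fin n → Matrix A A ℂ) :
    (piMatrix N).conjTranspose = piMatrix fun t => (N t).conjTranspose := by
  ext u v
  simp [Matrix.conjTranspose_apply, piMatrix_apply]

theorem piMatrix_one [DecidableEq A] : piMatrix (fun _ : Fin n => (1 : Matrix A A ℂ)) = 1 := by
  ext u v
  simp only [piMatrix_apply, Matrix.one_apply]
  split_ifs with h
  · simp [h]
  · obtain ⟨t, ht⟩ := Function.ne_iff.1 h
    exact Finset.prod_eq_zero (Finset.mem_univ t) (if_neg ht)

theorem sum_piMatrix {O : Type} [Fintype O] (N : Fin n → O → Matrix A A ℂ) :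
    ∑ o : Fin n → O, piMatrix (fun t => N t (o t)) = piMatrix fun t => ∑ a, N t a := by
  ext u v
  simp only [Matrix.sum_apply, piMatrix_apply]
  exact complex_sum_prod_pi fun t a => N t a (u t) (v t)

open scoped MatrixOrder in
theorem exists_eq_conjTranspose_mul_self [Fintype A] {N : Matrix A A ℂ} (hN : N.PosSemidef) :
    ∃ q : Matrix A A ℂ, N = q.conjTranspose * q := by
  classical
  exact CStarAlgebra.nonneg_iff_eq_star_mul_self.mp hN.nonneg

/-- Each factor is $q^*q$, and tensor products respect products and adjoints, so the whole is again
of this form. -/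
theorem posSemidef_piMatrix [Fintype A] {N : Fin n → Matrix A A ℂ} (hN : ∀ t, (N t).PosSemidef) :
    (piMatrix N).PosSemidef := by
  choose q hq using fun t => exists_eq_conjTranspose_mul_self (hN t)
  rw [show N = fun t => (q t).conjTranspose * q t from funext hq, ← piMatrix_mul,
    ← conjTranspose_piMatrix]
  exact Matrix.posSemidef_conjTranspose_mul_self _

theorem isPOVM_piMatrix [Fintype A] [DecidableEq A] {O : Type} [Fintype O]
    {N : Fin n → O → Matrix A A ℂ} (hN : ∀ t, IsPOVM (N t)) :
    IsPOVM fun o : Fin n → O => piMatrix fun t => N t (o t) := by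
  refine ⟨fun _ => posSemidef_piMatrix fun t => (hN t).1 _, ?_⟩
  rw [sum_piMatrix]
  simp only [(hN _).2]
  exact piMatrix_one

theorem IsPOVM.comp_equiv [Fintype A] [DecidableEq A] {O O' : Type} [Fintype O] [Fintype O']
    {N : O → Matrix A A ℂ} (hN : IsPOVM N) (e : O' ≃ O) : IsPOVM fun o => N (e o) :=
  ⟨fun _ => hN.1 _, (Equiv.sum_comp e N).trans hN.2⟩

theorem trace_pairProduct_mul [Fintype A] [Fintype B] (σ : Fin n → Matrix (A × B) (A × B) ℂ)
    (N : Fin n → Matrix A A ℂ) (N' : Fin n → Matrix B B ℂ) :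
    (pairProduct σ * (piMatrix N ⊗ₖ piMatrix N')).trace
      = ∏ t, (σ t * (N t ⊗ₖ N' t)).trace := by
  have hsum : ∀ f : Fin n → A × B → ℂ, ∑ u : (Fin n → A) × (Fin n → B), ∏ t, f t (u.1 t, u.2 t)
      = ∏ t, ∑ a, f t a := by
    intro f
    rw [← complex_sum_prod_pi, ← Equiv.sum_comp (Equiv.arrowProdEquivProdArrow (Fin n) (fun _ => A) fun _ => B)]
    rfl
  simp only [Matrix.trace, Matrix.diag_apply, Matrix.mul_apply, Matrix.kroneckerMap_apply, pairProduct,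
    Matrix.of_apply, piMatrix_apply, ← Finset.prod_mul_distrib]
  rw [← hsum]
  refine Finset.sum_congr rfl fun u _ => ?_
  exact hsum fun t a => σ t (u.1 t, u.2 t) a * (N t a.1 (u.1 t) * N' t a.2 (u.2 t))

theorem isState_pairProduct [Fintype A] [Fintype B] {σ : Fin n → Matrix (A × B) (A × B) ℂ}
    (hσ : ∀ t, IsState (σ t)) : IsState (pairProduct σ) := by
  classical
  -- `pairProduct` is `piMatrix` reindexed along $A^n\times B^n\cong(A\times B)^n$.
  refine ⟨(posSemidef_piMatrix fun t => (hσ t).1).submatrix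
    fun (u : (Fin n → A) × (Fin n → B)) t => (u.1 t, u.2 t), ?_⟩
  have h := trace_pairProduct_mul σ (fun _ => 1) fun _ => 1
  rw [piMatrix_one, piMatrix_one, Matrix.one_kronecker_one, mul_one] at h
  rw [h]
  simp [(hσ _).2]

end PiMatrix

/-! ### Boxes realized by entangled states -/

section Box

variable {A B : Type} [Fintype A] [Fintype B]

/-- Reality of the Born weights allows the real part to pass through the product over channel uses.
-/
theorem trace_mul_kronecker_im {σ : Matrix (A × B) (A × B) ℂ} (hσ : σ.IsHermitian)
    {N : Matrix A A ℂ} {N' : Matrix B B ℂ} (hN : N.IsHermitian) (hN' : N'.IsHermitian) :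
    (σ * (N ⊗ₖ N')).trace = ((σ * (N ⊗ₖ N')).trace.re : ℂ) := by
  have h : star (σ * (N ⊗ₖ N')).trace = (σ * (N ⊗ₖ N')).trace := by
    rw [← Matrix.trace_conjTranspose, Matrix.conjTranspose_mul, Matrix.conjTranspose_kronecker,
      hσ.eq, hN.eq, hN'.eq, Matrix.trace_mul_comm]
  exact (Complex.conj_eq_iff_re.1 h).symm

/-- The box that the measurements `PA`, `PB` on the state `σ` realize. -/
def bornBox (σ : Matrix (A × B) (A × B) ℂ) (PA : Bool → Bool → Matrix A A ℂ)
    (PB : Bool → Bool → Matrix B B ℂ) (u v a b : Bool) : ℝ :=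
  (σ * (PA u a ⊗ₖ PB v b)).trace.re

theorem sum_bornBox [DecidableEq A] [DecidableEq B] {σ : Matrix (A × B) (A × B) ℂ}
    (hσ : IsState σ) {PA : Bool → Bool → Matrix A A ℂ} {PB : Bool → Bool → Matrix B B ℂ}
    (hA : ∀ u, IsPOVM (PA u)) (hB : ∀ v, IsPOVM (PB v)) (u v : Bool) :
    ∑ a, ∑ b, bornBox σ PA PB u v a b = 1 := by
  have h : ∑ a, ∑ b, σ * (PA u a ⊗ₖ PB v b) = σ := by
    simp only [← Finset.mul_sum]
    have e : ∑ a, ∑ b, PA u a ⊗ₖ PB v b = 1 := by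
      have h1 := (hA u).2
      have h2 := (hB v).2
      simp only [Fintype.sum_bool, ← Matrix.kronecker_add, ← Matrix.add_kronecker] at h1 h2 ⊢
      rw [h1, h2, Matrix.one_kronecker_one]
    rw [e, mul_one]
  simp only [bornBox, ← Complex.re_sum, ← Matrix.trace_sum]
  rw [h, hσ.2, Complex.one_re]

theorem boxBehaviour_bornBox [DecidableEq A] [DecidableEq B] {σ : Matrix (A × B) (A × B) ℂ}
    (hσ : IsState σ) {PA : Bool → Bool → Matrix A A ℂ} {PB : Bool → Bool → Matrix B B ℂ}
    (hA : ∀ u, IsPOVM (PA u)) (hB : ∀ v, IsPOVM (PB v)) {n M₁ M₂ k₁ k₂ : ℕ}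
    (i₁ : Fin k₁ ≃ (Fin n → Bool)) (i₂ : Fin k₂ ≃ (Fin n → Bool))
    (F₁ : Fin n → Fin M₁ → Bool) (F₂ : Fin n → Fin M₂ → Bool) :
    boxBehaviour (bornBox σ PA PB) F₁ F₂ = measuredBehaviour (pairProduct fun _ : Fin n => σ)
      (fun m o => piMatrix fun t => PA (F₁ t m) (i₁ o t))
      (fun m o => piMatrix fun t => PB (F₂ t m) (i₂ o t))
      (fun m o t => (F₁ t m, i₁ o t)) (fun m o t => (F₂ t m, i₂ o t)) := by
  funext m₁ m₂ x₁ x₂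
  unfold boxBehaviour measuredBehaviour
  rw [← Equiv.sum_comp i₁]
  refine Finset.sum_congr rfl fun o₁ _ => ?_
  rw [← Equiv.sum_comp i₂]
  refine Finset.sum_congr rfl fun o₂ _ => ?_
  refine if_congr Iff.rfl ?_ rfl
  rw [trace_pairProduct_mul, Finset.prod_congr rfl fun t _ => trace_mul_kronecker_im hσ.1.isHermitian
    ((hA (F₁ t m₁)).1 (i₁ o₁ t)).isHermitian ((hB (F₂ t m₂)).1 (i₂ o₂ t)).isHermitian,
    ← Complex.ofReal_prod, Complex.ofReal_re]
  rfl

theorem boxBehaviour_bornBox_mem_qubitStrategies {d : ℕ}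
    {σ : Matrix (Fin 2 × Fin d) (Fin 2 × Fin d) ℂ}
    (hσ : IsState σ) {PA : Bool → Bool → Matrix (Fin 2) (Fin 2) ℂ}
    {PB : Bool → Bool → Matrix (Fin d) (Fin d) ℂ}
    (hA : ∀ u, IsPOVM (PA u)) (hB : ∀ v, IsPOVM (PB v)) (n M₁ M₂ : ℕ)
    (F₁ : Fin n → Fin M₁ → Bool) (F₂ : Fin n → Fin M₂ → Bool) :
    boxBehaviour (bornBox σ PA PB) F₁ F₂ ∈ qubitStrategies d n M₁ M₂ := by
  let i : Fin (Fintype.card (Fin n → Bool)) ≃ (Fin n → Bool) := (Fintype.equivFin _).symm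
  refine ⟨_, _, fun _ => σ, _, _, _, _, fun _ => hσ, fun m => ?_, fun m => ?_,
    boxBehaviour_bornBox hσ hA hB i i F₁ F₂⟩
  · exact (isPOVM_piMatrix fun t => hA (F₁ t m)).comp_equiv i
  · exact (isPOVM_piMatrix fun t => hB (F₂ t m)).comp_equiv i

end Box

theorem IsPOVM.submatrix {A A' O : Type} [DecidableEq A] [DecidableEq A'] [Fintype O]
    {N : O → Matrix A A ℂ} (hN : IsPOVM N) (e : A' ≃ A) : IsPOVM fun o => (N o).submatrix e e := by
  refine ⟨fun o => (hN.1 o).submatrix e, ?_⟩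
  ext i j
  have h := congrFun (congrFun hN.2 (e i)) (e j)
  simp only [Matrix.sum_apply, Matrix.submatrix_apply] at h ⊢
  simp [h, Matrix.one_apply]

theorem trace_submatrix_equiv {A A' : Type} [Fintype A] [Fintype A'] (N : Matrix A A ℂ)
    (e : A' ≃ A) : (N.submatrix e e).trace = N.trace :=
  Equiv.sum_comp e fun i => N i i

theorem qubitStrategies_subset {X₁ X₂ : Type} [DecidableEq X₁] [DecidableEq X₂] (d n M₁ M₂ : ℕ) :
    (qubitStrategies d n M₁ M₂ : Set (Behaviour X₁ X₂ n M₁ M₂)) ⊆ quantumStrategies n M₁ M₂ := by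
  rintro Q ⟨k₁, k₂, σ, P₁, P₂, e₁, e₂, hσ, h₁, h₂, rfl⟩
  let eA : Fin (Fintype.card (Fin n → Fin 2)) ≃ (Fin n → Fin 2) := (Fintype.equivFin _).symm
  let eB : Fin (Fintype.card (Fin n → Fin d)) ≃ (Fin n → Fin d) := (Fintype.equivFin _).symm
  have hs := isState_pairProduct hσ
  refine ⟨_, _, k₁, k₂, (pairProduct σ).submatrix (eA.prodCongr eB) (eA.prodCongr eB),
    fun m o => (P₁ m o).submatrix eA eA, fun m o => (P₂ m o).submatrix eB eB, e₁, e₂,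
    ⟨hs.1.submatrix _, (trace_submatrix_equiv _ _).trans hs.2⟩, fun m => (h₁ m).submatrix eA,
    fun m => (h₂ m).submatrix eB, ?_⟩
  funext m₁ m₂ x₁ x₂
  refine Finset.sum_congr rfl fun o₁ _ => Finset.sum_congr rfl fun o₂ _ => ?_
  have e : ((P₁ m₁ o₁).submatrix eA eA) ⊗ₖ ((P₂ m₂ o₂).submatrix eB eB)
      = (P₁ m₁ o₁ ⊗ₖ P₂ m₂ o₂).submatrix (eA.prodCongr eB) (eA.prodCongr eB) := by
    ext u v
    rfl
  rw [e, Matrix.submatrix_mul_equiv, trace_submatrix_equiv]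

/-! ### The CHSH strategy and its embedding in a `d`-level system -/

/-- The two-outcome measurement of the projection `N`. -/
def projPair {A : Type} [DecidableEq A] (N : Matrix A A ℂ) (b : Bool) : Matrix A A ℂ :=
  if b then 1 - N else N

theorem isPOVM_projPair {A : Type} [Fintype A] [DecidableEq A] {N : Matrix A A ℂ}
    (hN : N.IsHermitian) (h : N * N = N) : IsPOVM (projPair N) := by
  have psd : ∀ P : Matrix A A ℂ, P.IsHermitian → P * P = P → P.PosSemidef := by
    intro P h1 h2
    have := Matrix.posSemidef_conjTranspose_mul_self P
    rwa [h1.eq, h2] at this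
  refine ⟨fun b => ?_, by simp [projPair]⟩
  cases b
  · exact psd N hN h
  · refine psd (1 - N) (Matrix.isHermitian_one.sub hN) ?_
    rw [mul_sub, sub_mul, sub_mul, h]
    simp

/-- The maximally entangled state of two qubits. -/
def bellState : Matrix (Fin 2 × Fin 2) (Fin 2 × Fin 2) ℂ :=
  (1 / 2 : ℂ) • Matrix.vecMulVec (fun i => if i.1 = i.2 then 1 else 0)
    (star fun i => if i.1 = i.2 then 1 else 0)

theorem trace_bellState_mul (N N' : Matrix (Fin 2) (Fin 2) ℂ) :
    (bellState * (N ⊗ₖ N')).trace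
      = 1 / 2 * (N 0 0 * N' 0 0 + N 0 1 * N' 0 1 + N 1 0 * N' 1 0 + N 1 1 * N' 1 1) := by
  simp [bellState, Matrix.trace, Matrix.mul_apply, Fintype.sum_prod_type, Matrix.vecMulVec_apply,
    Matrix.kroneckerMap_apply]
  ring

theorem isState_bellState : IsState bellState := by
  refine ⟨(Matrix.posSemidef_vecMulVec_self_star _).smul ?_, ?_⟩
  · rw [Complex.le_def]
    norm_num
  · have h := trace_bellState_mul 1 1
    rw [Matrix.one_kronecker_one, mul_one] at h
    rw [h]
    simp
    norm_num

/-- The isometry of a qubit onto the first two levels of a `d`-level system. -/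
def qubitEmbedding {d : ℕ} (hd : 2 ≤ d) : Matrix (Fin d) (Fin 2) ℂ :=
  Matrix.of fun i k => if i = Fin.castLE hd k then 1 else 0

section Embedding

variable {d : ℕ} {V : Matrix (Fin d) (Fin 2) ℂ}

theorem conjTranspose_mul_qubitEmbedding (hd : 2 ≤ d) :
    (qubitEmbedding hd).conjTranspose * qubitEmbedding hd = 1 := by
  ext i j
  simp only [Matrix.mul_apply, Matrix.conjTranspose_apply, qubitEmbedding, Matrix.of_apply]
  rw [Finset.sum_eq_single (Fin.castLE hd i)]
  · simp [Matrix.one_apply]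
  · intro k _ hk
    simp [hk]
  · simp

/-- A state of two qubits, carried over to a qubit and a `d`-level system. -/
def embedState (V : Matrix (Fin d) (Fin 2) ℂ) (σ : Matrix (Fin 2 × Fin 2) (Fin 2 × Fin 2) ℂ) :
    Matrix (Fin 2 × Fin d) (Fin 2 × Fin d) ℂ :=
  ((1 : Matrix (Fin 2) (Fin 2) ℂ) ⊗ₖ V) * σ * ((1 : Matrix (Fin 2) (Fin 2) ℂ) ⊗ₖ V).conjTranspose

theorem trace_embedState_mul (σ : Matrix (Fin 2 × Fin 2) (Fin 2 × Fin 2) ℂ)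
    (N : Matrix (Fin 2) (Fin 2) ℂ) (Y : Matrix (Fin d) (Fin d) ℂ) :
    (embedState V σ * (N ⊗ₖ Y)).trace = (σ * (N ⊗ₖ (V.conjTranspose * Y * V))).trace := by
  let U : Matrix (Fin 2 × Fin d) (Fin 2 × Fin 2) ℂ := (1 : Matrix (Fin 2) (Fin 2) ℂ) ⊗ₖ V
  have e : N ⊗ₖ (V.conjTranspose * Y * V) = U.conjTranspose * (N ⊗ₖ Y) * U := by
    simp only [U, Matrix.conjTranspose_kronecker, Matrix.conjTranspose_one,
      ← Matrix.mul_kronecker_mul, Matrix.one_mul, Matrix.mul_one]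
  rw [e, show embedState V σ = U * σ * U.conjTranspose from rfl, Matrix.mul_assoc,
    Matrix.mul_assoc, Matrix.trace_mul_comm]
  simp only [Matrix.mul_assoc]

theorem isState_embedState (hV : V.conjTranspose * V = 1)
    {σ : Matrix (Fin 2 × Fin 2) (Fin 2 × Fin 2) ℂ} (hσ : IsState σ) : IsState (embedState V σ) := by
  refine ⟨hσ.1.mul_mul_conjTranspose_same _, ?_⟩
  have h := trace_embedState_mul (V := V) σ 1 1
  rwa [Matrix.mul_one, hV, Matrix.one_kronecker_one, Matrix.one_kronecker_one, Matrix.mul_one,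
    Matrix.mul_one, hσ.2] at h

/-- The outcome `true` also takes up the complement of the range of $V$, which the embedded state
never meets; compression by $V$ restores the qubit measurement. -/
theorem conj_projPair (hV : V.conjTranspose * V = 1) (N : Matrix (Fin 2) (Fin 2) ℂ) (b : Bool) :
    V.conjTranspose * projPair (V * N * V.conjTranspose) b * V = projPair N b := by
  have e : V.conjTranspose * (V * N * V.conjTranspose) * V = N := by
    rw [show V.conjTranspose * (V * N * V.conjTranspose) * V
      = (V.conjTranspose * V) * N * (V.conjTranspose * V) by simp only [Matrix.mul_assoc], hV, one_mul,
      mul_one]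
  cases b
  · simpa [projPair] using e
  · simp only [projPair, if_true, Matrix.mul_sub, Matrix.sub_mul]
    rw [Matrix.mul_one, hV, e]

end Embedding

/-- First sender: projections onto the angles `0` and `π / 4`. -/
def chshA (u : Bool) : Matrix (Fin 2) (Fin 2) ℂ :=
  if u then !![1 / 2, 1 / 2; 1 / 2, 1 / 2] else !![1, 0; 0, 0]

/-- Second sender: projections onto the angles `π / 8` and `-π / 8`. -/
def chshB (v : Bool) : Matrix (Fin 2) (Fin 2) ℂ :=
  if v then !![1 / 2 + (√2 / 4 : ℝ), -(√2 / 4 : ℝ); -(√2 / 4 : ℝ), 1 / 2 - (√2 / 4 : ℝ)]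
  else !![1 / 2 + (√2 / 4 : ℝ), (√2 / 4 : ℝ); (√2 / 4 : ℝ), 1 / 2 - (√2 / 4 : ℝ)]

theorem chshA_isHermitian (u : Bool) : (chshA u).IsHermitian := by
  cases u <;> ext i j <;> fin_cases i <;> fin_cases j <;> simp [chshA]

theorem chshA_mul_self (u : Bool) : chshA u * chshA u = chshA u := by
  cases u <;> ext i j <;> fin_cases i <;> fin_cases j <;> simp [chshA] <;> norm_num

theorem chshB_isHermitian (v : Bool) : (chshB v).IsHermitian := by
  cases v <;> ext i j <;> fin_cases i <;> fin_cases j <;> simp [chshB, -Complex.ofReal_div]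

theorem chshB_mul_self (v : Bool) : chshB v * chshB v = chshB v := by
  have hq : ((√2 / 4 : ℝ) : ℂ) * ((√2 / 4 : ℝ) : ℂ) = 1 / 8 := by
    rw [← Complex.ofReal_mul, div_mul_div_comm, Real.mul_self_sqrt two_pos.le]
    norm_num
  generalize hc : ((√2 / 4 : ℝ) : ℂ) = q at hq
  cases v <;> ext i j <;> fin_cases i <;> fin_cases j <;>
    simp [chshB, -Complex.ofReal_div, hc] <;> first | linear_combination 2 * hq | ring

theorem cos_pi_div_eight_sq : Real.cos (Real.pi / 8) ^ 2 = 1 / 2 + √2 / 4 := by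
  rw [Real.cos_pi_div_eight, div_pow, Real.sq_sqrt (by positivity)]
  ring

/-- On the Bell state, real projections at angle difference $\theta$ give equal outcomes with
probability $\cos^2\theta$. Here $\theta=\pm\pi/8$ except for $u=v=1$, where $\theta=3\pi/8$ and
unequal outcomes, which win, have probability $\sin^2(3\pi/8)=\cos^2(\pi/8)$. -/
theorem chsh_value {d : ℕ} (hd : 2 ≤ d) (u v : Bool) :
    let V := qubitEmbedding hd
    let P := bornBox (embedState V bellState) (fun u => projPair (chshA u))
      fun v => projPair (V * chshB v * V.conjTranspose)
    P u v false (u && v) + P u v true (!(u && v)) = Real.cos (Real.pi / 8) ^ 2 := by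
  intro V P
  have e : ∀ a b, P u v a b = (1 / 2 * (projPair (chshA u) a 0 0 * projPair (chshB v) b 0 0
      + projPair (chshA u) a 0 1 * projPair (chshB v) b 0 1
      + projPair (chshA u) a 1 0 * projPair (chshB v) b 1 0
      + projPair (chshA u) a 1 1 * projPair (chshB v) b 1 1)).re := by
    intro a b
    rw [← trace_bellState_mul]
    simp only [P, bornBox]
    rw [trace_embedState_mul, conj_projPair (conjTranspose_mul_qubitEmbedding hd)]
  rw [e, e, cos_pi_div_eight_sq, ← Complex.add_re, ← Complex.ofReal_re (1 / 2 + √2 / 4)]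
  congr 1
  cases u <;> cases v <;> simp [projPair, chshA, chshB] <;> ring

theorem le_sumCapacity_qubitStrategies {d : ℕ} (hd : 2 ≤ d)
    {S : StrategyClass (Bool × Bool) (Bool × Bool)}
    (hS : ∀ n M₁ M₂, qubitStrategies d n M₁ M₂ ⊆ S n M₁ M₂) {ε : ℝ} (hε : ε ∈ Set.Icc (0 : ℝ) 1) :
    ((2 * Real.cos (Real.pi / 8) ^ 2 * ε : ℝ) : EReal) ≤ sumCapacity (channelII ε hε) S := by
  have hV := conjTranspose_mul_qubitEmbedding hd
  have hσ := isState_embedState hV isState_bellState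
  have hA : ∀ u, IsPOVM (projPair (chshA u)) := fun u =>
    isPOVM_projPair (chshA_isHermitian u) (chshA_mul_self u)
  have hB : ∀ v, IsPOVM (projPair (qubitEmbedding hd * chshB v * (qubitEmbedding hd).conjTranspose)) := by
    refine fun v => isPOVM_projPair (Matrix.isHermitian_mul_mul_conjTranspose _ (chshB_isHermitian v)) ?_
    rw [show ∀ X : Matrix (Fin d) (Fin 2) ℂ, X * chshB v * X.conjTranspose * (X * chshB v * X.conjTranspose)
      = X * (chshB v * (X.conjTranspose * X) * chshB v) * X.conjTranspose by
        intro X; simp only [Matrix.mul_assoc], hV, mul_one, chshB_mul_self]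
  exact le_sumCapacity_of_box hε (sq_nonneg _) (Real.cos_sq_le_one _) (sum_bornBox hσ hA hB)
    (chsh_value hd) fun n M₁ M₂ F₁ F₂ =>
      hS _ _ _ (boxBehaviour_bornBox_mem_qubitStrategies hσ hA hB n M₁ M₂ F₁ F₂)

theorem classical_lt_quantum {ε : ℝ} (h0 : 0 < ε) (h1 : ε < 1 / 10000) :
    (1.183 * ε + 2 * ε ^ 2) / Real.log 2 < 2 * Real.cos (Real.pi / 8) ^ 2 * ε := by
  have hl : 0 < Real.log 2 := Real.log_pos one_lt_two
  have hl2 := Real.log_two_gt_d9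
  have hs : (1.41421 : ℝ) < √2 := Real.lt_sqrt_of_sq_lt (by norm_num)
  rw [div_lt_iff₀ hl, cos_pi_div_eight_sq]
  -- Numerically $1.1832<1.18328$; this margin dictates the bound $\varepsilon<1/10000$.
  have : 1.183 + 2 * ε < (1 + √2 / 2) * Real.log 2 := by
    nlinarith [mul_pos (sub_pos.2 hs) (sub_pos.2 hl2)]
  nlinarith

end Interference

end

theorem mainTheorem4 :
    -- the entanglement-assisted achievable rate, for every value of the parameter
    (∀ (ε : ℝ) (hε : ε ∈ Set.Icc (0 : ℝ) 1),
      ((2 * Real.cos (Real.pi / 8) ^ 2 * ε : ℝ) : EReal) ≤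
          Interference.sumCapacity (Interference.channelII ε hε)
            Interference.quantumStrategies ∧
      ∀ d : ℕ, 2 ≤ d →
        ((2 * Real.cos (Real.pi / 8) ^ 2 * ε : ℝ) : EReal) ≤
          Interference.sumCapacity (Interference.channelII ε hε)
            (Interference.qubitStrategies d)) ∧
    -- the classical upper bound (1.255 nats are 1.255 / log 2 bits) and the strict separation
    ∃ (K ε₀ : ℝ), 0 < ε₀ ∧
      ∀ (ε : ℝ) (hε : ε ∈ Set.Icc (0 : ℝ) 1), 0 < ε → ε < ε₀ →
        Interference.sumCapacity (Interference.channelII ε hε)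
            Interference.classicalStrategies ≤
          ((1.255 / Real.log 2 * ε + K * ε ^ 2 : ℝ) : EReal) ∧
        Interference.sumCapacity (Interference.channelII ε hε)
            Interference.classicalStrategies <
          Interference.sumCapacity (Interference.channelII ε hε)
            Interference.quantumStrategies ∧
        ∀ d : ℕ, 2 ≤ d →
          Interference.sumCapacity (Interference.channelII ε hε)
              Interference.classicalStrategies <
            Interference.sumCapacity (Interference.channelII ε hε)
              (Interference.qubitStrategies d) := by
  have hq : ∀ (ε : ℝ) (hε : ε ∈ Set.Icc (0 : ℝ) 1), ((2 * Real.cos (Real.pi / 8) ^ 2 * ε : ℝ) : EReal) ≤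
      Interference.sumCapacity (Interference.channelII ε hε) Interference.quantumStrategies :=
    fun ε hε => Interference.le_sumCapacity_qubitStrategies le_rfl
      (Interference.qubitStrategies_subset 2) hε
  have hd : ∀ (ε : ℝ) (hε : ε ∈ Set.Icc (0 : ℝ) 1) (d : ℕ), 2 ≤ d →
      ((2 * Real.cos (Real.pi / 8) ^ 2 * ε : ℝ) : EReal) ≤
        Interference.sumCapacity (Interference.channelII ε hε) (Interference.qubitStrategies d) :=
    fun ε hε d h => Interference.le_sumCapacity_qubitStrategies h (fun _ _ _ => subset_rfl) hε
  -- $K=2/\ln2$ is the erasure term $2\varepsilon^2$ converted from nats to bits.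
  refine ⟨fun ε hε => ⟨hq ε hε, hd ε hε⟩, 2 / Real.log 2, 1 / 10000, by norm_num, ?_⟩
  intro ε hε h0 h1
  have hc := Interference.classical_sumCapacity_le hε h0 (by linarith)
  have hlt := EReal.coe_lt_coe_iff.2 (Interference.classical_lt_quantum h0 h1)
  refine ⟨hc.trans (EReal.coe_le_coe_iff.2 ?_), (hc.trans_lt hlt).trans_le (hq ε hε),
    fun d h => (hc.trans_lt hlt).trans_le (hd ε hε d h)⟩
  rw [add_div, mul_div_right_comm, mul_div_right_comm]
  have hl : 0 < Real.log 2 := Real.log_pos one_lt_two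
  gcongr
  norm_num
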